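/- Let $p,r,n\ge 1$ be integers. An I-Fibonacci $(p,r)$-code of length $n$ is a binary word of length $n$ with at most $r$ consecutive $1$s, in which any two distinct maximal blocks of $1$s are separated by at least $p$ letters $0$. Let $I\Gamma_n^{(p,r)}$ be the graph whose vertices are the I-Fibonacci $(p,r)$-codes of length $n$, two of them being adjacent if and only if they differ in exactly one coordinate. Then the following hold. (1) If $p=1$, then $\operatorname{diam}(I\Gamma_n^{(p,r)})=n$ for all $n\ge 1$. (2) Let $p\ge 2$. (2.1) If $r<p$, then $\operatorname{diam}(I\Gamma_n^{(p,r)})=2r\left\lfloor\frac{n}{p+r}\right\rfloor+\min\{n \bmod (p+r),\,2r\}$ for all $n\ge 1$. (2.2) If $p\le r\le p+1$, then $\operatorname{diam}(I\Gamma_n^{(p,r)})=n$ for all $n\ge 1$. (2.3) If $p+2\le r\le 2p+2$, then $\operatorname{diam}(I\Gamma_n^{(p,r)})=n$ for all $n\ge 1$. (2.4) If $r\ge 2p+3$ and $1\le n<2p+3$, then $\operatorname{diam}(I\Gamma_n^{(p,r)})=n$. (2.5) If $r\ge 2p+3$, then there are integers $c\ge 1$ and $r'$ with $2p+3\le r'\le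 r$, depending only on $p$ and $r$, such that for all $n\ge 2p+3$ $$n+c\left\lfloor\frac{n}{r'+p}\right\rfloor\le \operatorname{diam}(I\Gamma_n^{(p,r)})\le n+c\left\lceil\frac{n}{r'}\right\rceil .$$ -/

import Mathlib

/-- A binary word `w` of length `n` is an I-Fibonacci `(p,r)`-code if it has at most `r`
consecutive `1`s (every window of `r + 1` consecutive letters contains a `0`), and if any block of
`0`s that lies between two `1`s has length at least `p`. -/
def IsIFibCode (p r : ℕ) {n : ℕ} (w : Fin n → Bool) : Prop :=
  (∀ i : ℕ, i + r < n → ∃ j : Fin n, i ≤ (j : ℕ) ∧ (j : ℕ) ≤ i + r ∧ w j = false) ∧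
  (∀ i j : Fin n, (i : ℕ) + 1 < (j : ℕ) → w i = true → w j = true →
    (∀ k : Fin n, i < k → k < j → w k = false) → p ≤ (j : ℕ) - (i : ℕ) - 1)

/-- The I-Fibonacci `(p,r)`-cube of dimension `n`: its vertices are the I-Fibonacci
`(p,r)`-codes of length `n`, two of them being adjacent if they differ in exactly one
coordinate. -/
def IFibCube (p r n : ℕ) : SimpleGraph {w : Fin n → Bool // IsIFibCode p r w} where
  Adj u v := hammingDist u.1 v.1 = 1
  symm := ⟨fun u v h => by rw [hammingDist_comm]; exact h⟩
  loopless := ⟨fun u h => by simp at h⟩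

/-! Words are treated as their supports, so a step of the graph inserts or erases one position.

Upper bounds. If `W ⊆ X ∩ Y` meets every block of `X` and of `Y` in an interval, both codes shrink
to `W` by erasing block ends, so their distance is at most `|X| + |Y| - 2|W|` (`diam_le_of_common`).
For `p = 1` every subset of a code is a code, and for `r < p` a block meets at most one block of the
other code, so `W = X ∩ Y` is allowed. In general a block of one code may meet `k + 1` blocks of the
other, in `σ` positions altogether, of which only one piece, of size `y ≥ σ / (k + 1)`, can be kept.
Such a block has length at least `σ + k * p` and costs `σ - 2y` beyond the bound `n`. A positive
cost needs `k ≥ 2` and `σ ≥ 3`, hence length at least `2p + 3`. The scan behind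
`exists_large_common` bounds the total cost by `n` times any bound `c / R` for the ratios `(σ - 2y)
/ (σ + k * p)`.

Lower bounds. A function that changes by at most one per step bounds the diameter from below
(`LipOn.le_diam`). Two disjoint words suffice if no block can have positive cost. Otherwise, full
blocks of length `R = σ + k * p` face patterns of `k + 1` short blocks; as `2 ≤ p`, steps cannot
merge blocks, and cardinality minus twice the longest run is a suitable function, which gains `R + σ
- 2y` on such a pair. A triple `(k, σ, y)` of maximal ratio (`exists_optimal_star`) serves both
bounds with the same `c = σ - 2y` and `r' = R`. -/

/-! ### Blocks and gaps of codes -/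

/-- A finite set of positions is a code if the word with this support is an I-Fibonacci
`(p,r)`-code. -/
def Code (p r : ℕ) (X : Finset ℕ) : Prop :=
  (∀ i, ∃ j, i ≤ j ∧ j ≤ i + r ∧ j ∉ X) ∧
  (∀ i j, i + 1 < j → i ∈ X → j ∈ X → (∀ k, i < k → k < j → k ∉ X) → i + p < j)

/-- `W` is convex inside every block of consecutive elements of `X`. -/
def ConvIn (W X : Finset ℕ) : Prop :=
  ∀ a b c, a ∈ W → c ∈ W → a < b → b < c → (∀ z, a ≤ z → z ≤ c → z ∈ X) → b ∈ W

theorem ConvIn.mono {W X X' : Finset ℕ} (h : ConvIn W X) (hX : X' ⊆ X) : ConvIn W X' :=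
  fun a b c ha hc hab hbc hz => h a b c ha hc hab hbc fun z h1 h2 => hX (hz z h1 h2)

theorem Code.length_le {p r : ℕ} {X : Finset ℕ} (hX : Code p r X) {a b : ℕ}
    (h : ∀ z, a ≤ z → z < b → z ∈ X) : b ≤ a + r := by
  obtain ⟨j, h1, h2, h3⟩ := hX.1 a
  by_contra hlt
  exact h3 (h j h1 (by omega))

theorem Code.exists_gap {p r : ℕ} {X : Finset ℕ} (hX : Code p r X) {a b z : ℕ}
    (ha : a ∈ X) (hb : b ∈ X) (hz : z ∉ X) (haz : a < z) (hzb : z < b) :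
    ∃ i j, a ≤ i ∧ i < z ∧ z < j ∧ j ≤ b ∧ i ∈ X ∧ j ∈ X ∧ i + p < j ∧
      ∀ k, i < k → k < j → k ∉ X := by
  classical
  have hne : (X.filter (· < z)).Nonempty := ⟨a, by simp [ha, haz]⟩
  have hne' : (X.filter (z < ·)).Nonempty := ⟨b, by simp [hb, hzb]⟩
  have hi := Finset.max'_mem _ hne
  have hj := Finset.min'_mem _ hne'
  have hia := Finset.le_max' (X.filter (· < z)) a (by simp [ha, haz])
  have hjb := Finset.min'_le (X.filter (z < ·)) b (by simp [hb, hzb])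
  have hbet : ∀ k, (X.filter (· < z)).max' hne < k → k < (X.filter (z < ·)).min' hne' → k ∉ X := by
    intro k h1 h2 hk
    rcases lt_trichotomy k z with h | h | h
    · exact absurd (Finset.le_max' (X.filter (· < z)) k (by simp [hk, h])) (by omega)
    · exact hz (h ▸ hk)
    · exact absurd (Finset.min'_le (X.filter (z < ·)) k (by simp [hk, h])) (by omega)
  simp only [Finset.mem_filter] at hi hj
  exact ⟨_, _, hia, hi.2, hj.2, hjb, hi.1, hj.1,
    hX.2 _ _ (by omega) hi.1 hj.1 hbet, hbet⟩

/-- For `p = 1` the separation condition is vacuous, and the bound on runs passes to subsets. -/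
theorem Code.subset_of_one {r : ℕ} {X W : Finset ℕ} (hX : Code 1 r X) (hW : W ⊆ X) :
    Code 1 r W := by
  refine ⟨fun i => ?_, fun i j hij _ _ _ => hij⟩
  obtain ⟨j, h1, h2, h3⟩ := hX.1 i
  exact ⟨j, h1, h2, fun h => h3 (hW h)⟩

/-- Erasing an end of a block only enlarges a gap, even if the block is a single letter. -/
theorem Code.erase {p r : ℕ} {X : Finset ℕ} (hX : Code p r X) {s : ℕ} (hs : s ∈ X)
    (hend : s + 1 ∉ X ∨ ∀ z, z + 1 = s → z ∉ X) : Code p r (X.erase s) := by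
  refine ⟨fun i => ?_, fun i j hij hi hj hbet => ?_⟩
  · obtain ⟨j, h1, h2, h3⟩ := hX.1 i
    exact ⟨j, h1, h2, fun h => h3 (Finset.mem_of_mem_erase h)⟩
  · have hi' := Finset.mem_of_mem_erase hi
    have hj' := Finset.mem_of_mem_erase hj
    have hbet' : ∀ k, i < k → k < j → k ≠ s → k ∉ X := fun k h1 h2 h3 h4 =>
      hbet k h1 h2 (Finset.mem_erase.2 ⟨h3, h4⟩)
    by_cases hsm : i < s ∧ s < j
    · obtain ⟨h1, h2⟩ := hsm
      rcases hend with h | h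
      · have := hX.2 s j (by
          rcases Nat.lt_or_ge (s + 1) j with h' | h'
          · exact h'
          · exact absurd hj' (by rwa [show j = s + 1 by omega])) hs hj'
          fun k h3 h4 => hbet' k (by omega) h4 (by omega)
        omega
      · have := hX.2 i s (by
          rcases Nat.lt_or_ge (i + 1) s with h' | h'
          · exact h'
          · exact absurd hi' (h i (by omega))) hi' hs
          fun k h3 h4 => hbet' k h3 (by omega) (by omega)
        omega
    · exact hX.2 i j hij hi' hj' fun k h1 h2 => hbet' k h1 h2 (by rintro rfl; exact hsm ⟨h1, h2⟩)

/-- A block end outside of a convex part can be erased. -/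
theorem Code.exists_erase {p r : ℕ} {X W : Finset ℕ} (hX : Code p r X) (hWX : W ⊆ X)
    (hW : ConvIn W X) (hne : W ≠ X) : ∃ s ∈ X, s ∉ W ∧ Code p r (X.erase s) := by
  classical
  obtain ⟨x, hxX, hxW⟩ : ∃ x ∈ X, x ∉ W := by
    by_contra! h
    exact hne (Finset.Subset.antisymm hWX h)
  -- `s` and `e - 1` will be the two ends of the block through `x`. They are not both in `W`, since
  -- convexity would then put `x` into `W`.
  have h1 : ∃ s, s ≤ x ∧ ∀ z, s ≤ z → z ≤ x → z ∈ X :=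
    ⟨x, le_rfl, fun z h1 h2 => (le_antisymm h2 h1) ▸ hxX⟩
  obtain ⟨hsx, hs⟩ := Nat.find_spec h1
  have hsmin := fun m (hm : m < Nat.find h1) => Nat.find_min h1 hm
  set s := Nat.find h1
  have h2 : ∃ e, x < e ∧ e ∉ X := by
    obtain ⟨j, h1, _, h3⟩ := hX.1 (x + 1)
    exact ⟨j, h1, h3⟩
  obtain ⟨hxe, he⟩ := Nat.find_spec h2
  have hemin := fun m (hm : m < Nat.find h2) => Nat.find_min h2 hm
  set e := Nat.find h2
  have hse : ∀ z, s ≤ z → z ≤ e - 1 → z ∈ X := by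
    intro z hz1 hz2
    rcases Nat.lt_or_ge x z with h | h
    · by_contra hz
      exact hemin z (by omega) ⟨h, hz⟩
    · exact hs z hz1 h
  by_cases hsW : s ∈ W
  · by_cases heW : e - 1 ∈ W
    · have hs' : s ≠ x := fun h => hxW (h ▸ hsW)
      have he' : e - 1 ≠ x := fun h => hxW (h ▸ heW)
      exact absurd (hW s x (e - 1) hsW heW (by omega) (by omega) hse) hxW
    · refine ⟨e - 1, hse _ (by omega) le_rfl, heW, hX.erase (hse _ (by omega) le_rfl) (Or.inl ?_)⟩
      rwa [show e - 1 + 1 = e by omega]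
  · refine ⟨s, hse _ le_rfl (by omega), hsW, hX.erase (hse _ le_rfl (by omega)) (Or.inr ?_)⟩
    intro z hz hzX
    refine hsmin z (by omega) ⟨by omega, fun w hw1 hw2 => ?_⟩
    rcases Nat.eq_or_lt_of_le hw1 with h | h
    · exact h ▸ hzX
    · exact hs w (by omega) hw2

theorem code_empty (p r : ℕ) : Code p r ∅ :=
  ⟨fun i => ⟨i, le_rfl, by omega, by simp⟩, fun i j _ hi => by simp at hi⟩

/-- A block of ones may be put in front of a code, either at distance at least `p` or merging with
the first block. -/
theorem Code.prepend {p r : ℕ} {X : Finset ℕ} (hX : Code p r X) {a l z : ℕ}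
    (hl : ∀ x ∈ X, a + l ≤ x) (hg : a + l ∈ X ∨ ∀ x ∈ X, a + l + p ≤ x)
    (hz : z ∉ X) (hz1 : a + l ≤ z) (hz2 : z ≤ a + r) : Code p r (Finset.Ico a (a + l) ∪ X) := by
  refine ⟨fun i => ?_, fun i j hij hi hj hbet => ?_⟩
  -- `z` is a zero after the new block and any block merged with it, so it serves every window that
  -- starts in `[a, z]`.
  · rcases Nat.lt_or_ge z i with h | h
    · obtain ⟨j, h1, h2, h3⟩ := hX.1 i
      refine ⟨j, h1, h2, ?_⟩
      simp only [Finset.mem_union, Finset.mem_Ico, not_or]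
      exact ⟨by omega, h3⟩
    · rcases Nat.lt_or_ge i a with h' | h'
      · refine ⟨i, le_rfl, by omega, ?_⟩
        simp only [Finset.mem_union, Finset.mem_Ico, not_or]
        exact ⟨by omega, fun hi => absurd (hl i hi) (by omega)⟩
      · refine ⟨z, h, by omega, ?_⟩
        simp only [Finset.mem_union, Finset.mem_Ico, not_or]
        exact ⟨by omega, hz⟩
  · simp only [Finset.mem_union, Finset.mem_Ico, not_or] at hi hj hbet
    rcases hj with hj | hj
    · rcases hi with hi | hi
      · exact absurd (hbet (i + 1) (by omega) hij).1 (by omega)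
      · exact absurd (hl i hi) (by omega)
    · rcases hi with hi | hi
      · have hi' : i + 1 = a + l := by
          by_contra h
          exact (hbet (i + 1) (by omega) hij).1 (by omega)
        rcases hg with hg | hg
        · exact absurd hg (hi' ▸ (hbet (i + 1) (by omega) hij).2)
        · have := hg j hj
          omega
      · exact hX.2 i j hij hi hj fun k h1 h2 => (hbet k h1 h2).2


/-! ### Convex common parts and the scan from the left -/

/-- There is a common part of `X` and `Y`, below `m`, with at least `A` elements, which meets
every block of `X` and every block of `Y` in an interval. -/
def HasCommon (X Y : Finset ℕ) (m A : ℕ) : Prop :=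
  ∃ W : Finset ℕ, (∀ w ∈ W, w ∈ X ∧ w ∈ Y ∧ w < m) ∧ ConvIn W X ∧ ConvIn W Y ∧ A ≤ W.card

/-- As `HasCommon`, for a common part that is disjoint from the block of `X` that ends before
`m`. -/
def HasCommonAvoiding (X Y : Finset ℕ) (m A : ℕ) : Prop :=
  ∃ W : Finset ℕ, (∀ w ∈ W, w ∈ X ∧ w ∈ Y ∧ w < m) ∧ ConvIn W X ∧ ConvIn W Y ∧ A ≤ W.card ∧
    ∀ w ∈ W, ∃ z, w < z ∧ z < m ∧ z ∉ X

theorem HasCommon.symm {X Y : Finset ℕ} {m A : ℕ} (h : HasCommon X Y m A) :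
    HasCommon Y X m A := by
  obtain ⟨W, h1, h2, h3, h4⟩ := h
  exact ⟨W, fun w hw => ⟨(h1 w hw).2.1, (h1 w hw).1, (h1 w hw).2.2⟩, h3, h2, h4⟩

theorem HasCommon.mono {X Y : Finset ℕ} {m m' A : ℕ} (h : HasCommon X Y m A) (hm : m ≤ m') :
    HasCommon X Y m' A := by
  obtain ⟨W, h1, h2, h3, h4⟩ := h
  exact ⟨W, fun w hw => ⟨(h1 w hw).1, (h1 w hw).2.1, (h1 w hw).2.2.trans_le hm⟩, h2, h3, h4⟩

theorem HasCommonAvoiding.mono {X Y : Finset ℕ} {m m' A : ℕ} (h : HasCommonAvoiding X Y m A)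
    (hm : m ≤ m') : HasCommonAvoiding X Y m' A := by
  obtain ⟨W, h1, h2, h3, h4, h5⟩ := h
  refine ⟨W, fun w hw => ⟨(h1 w hw).1, (h1 w hw).2.1, (h1 w hw).2.2.trans_le hm⟩, h2, h3, h4,
    fun w hw => ?_⟩
  obtain ⟨z, hz1, hz2, hz3⟩ := h5 w hw
  exact ⟨z, hz1, hz2.trans_le hm, hz3⟩

theorem HasCommon.avoiding {X Y : Finset ℕ} {m m' z A : ℕ} (h : HasCommon X Y m A)
    (hz : m ≤ z) (hz' : z < m') (hzX : z ∉ X) : HasCommonAvoiding X Y m' A := by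
  obtain ⟨W, h1, h2, h3, h4⟩ := h
  exact ⟨W, fun w hw => ⟨(h1 w hw).1, (h1 w hw).2.1, by have := (h1 w hw).2.2; omega⟩, h2, h3, h4,
    fun w hw => ⟨z, (h1 w hw).2.2.trans_le hz, hz', hzX⟩⟩

theorem HasCommon.avoiding_of_pred {X Y : Finset ℕ} {s A : ℕ} (h : HasCommon X Y s A)
    (hs : ∀ z, z + 1 = s → z ∉ X) : HasCommonAvoiding X Y s A := by
  obtain ⟨W, h1, h2, h3, h4⟩ := h
  refine ⟨W, h1, h2, h3, h4, fun w hw => ⟨s - 1, ?_, ?_, hs _ ?_⟩⟩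
  all_goals have := (h1 w hw).2.2
  · rcases Nat.lt_or_ge w (s - 1) with h | h
    · exact h
    · exact absurd (h1 w hw).1 (hs w (by omega))
  · omega
  · omega

theorem HasCommon.symm_avoiding_of_pred {X Y : Finset ℕ} {s A : ℕ} (h : HasCommon X Y s A)
    (hs : ∀ z, z + 1 = s → z ∉ Y) : HasCommonAvoiding Y X s A :=
  h.symm.avoiding_of_pred hs

/-- No run of `X` leads from `W` into `[s, e)`, because each element of `W` is followed by a zero of
`X` before `s`. -/
theorem convIn_union_Ico {W X : Finset ℕ} {s e : ℕ} (hW : ConvIn W X)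
    (hWs : ∀ w ∈ W, ∃ z, w < z ∧ z < s ∧ z ∉ X) : ConvIn (W ∪ Finset.Ico s e) X := by
  intro a b c ha hc hab hbc hz
  simp only [Finset.mem_union, Finset.mem_Ico] at ha hc ⊢
  rcases hc with hc | hc
  · rcases ha with ha | ha
    · exact Or.inl (hW a b c ha hc hab hbc hz)
    · obtain ⟨z, h1, h2, _⟩ := hWs c hc
      omega
  · rcases ha with ha | ha
    · obtain ⟨z, h1, h2, h3⟩ := hWs a ha
      exact absurd (hz z h1.le (by omega)) h3
    · right; omega

/-- The whole overlap `[s, e)` may be added: the old part avoids the current block of `X`, and a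
block of `Y` only starts at `s`. -/
theorem HasCommonAvoiding.extend {X Y : Finset ℕ} {s e A : ℕ} (h : HasCommonAvoiding X Y s A)
    (hs : ∀ z, z + 1 = s → z ∉ Y) (hse : s ≤ e) (he : ∀ z, s ≤ z → z < e → z ∈ X ∧ z ∈ Y) :
    HasCommon X Y e (A + (e - s)) := by
  obtain ⟨W, h1, h2, h3, h4, h5⟩ := h
  have h6 : ∀ w ∈ W, ∃ z, w < z ∧ z < s ∧ z ∉ Y := by
    intro w hw
    have hws := (h1 w hw).2.2
    refine ⟨s - 1, ?_, by omega, hs _ (by omega)⟩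
    rcases Nat.lt_or_ge w (s - 1) with h | h
    · exact h
    · exact absurd (h1 w hw).2.1 (hs w (by omega))
  refine ⟨W ∪ Finset.Ico s e, ?_, convIn_union_Ico h2 h5, convIn_union_Ico h3 h6, ?_⟩
  · intro w hw
    simp only [Finset.mem_union, Finset.mem_Ico] at hw
    rcases hw with hw | hw
    · exact ⟨(h1 w hw).1, (h1 w hw).2.1, by have := (h1 w hw).2.2; omega⟩
    · exact ⟨(he w hw.1 hw.2).1, (he w hw.1 hw.2).2, hw.2⟩
  · rw [Finset.card_union_of_disjoint]
    · simp only [Nat.card_Ico]; omega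
    · rw [Finset.disjoint_left]
      intro w hw hw'
      have := (h1 w hw).2.2
      simp only [Finset.mem_Ico] at hw'
      omega

/-- The number of common elements of `X` and `Y` below `m`. -/
def overlap (X Y : Finset ℕ) (m : ℕ) : ℕ := ((X ∩ Y).filter (· < m)).card

theorem overlap_comm (X Y : Finset ℕ) (m : ℕ) : overlap X Y m = overlap Y X m := by
  rw [overlap, overlap, Finset.inter_comm]

theorem overlap_run {X Y : Finset ℕ} {s e : ℕ} (hse : s ≤ e)
    (he : ∀ z, s ≤ z → z < e → z ∈ X ∧ z ∈ Y) : overlap X Y e = overlap X Y s + (e - s) := by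
  have : (X ∩ Y).filter (· < e) = (X ∩ Y).filter (· < s) ∪ Finset.Ico s e := by
    ext w
    simp only [Finset.mem_filter, Finset.mem_inter, Finset.mem_union, Finset.mem_Ico]
    constructor
    · rintro ⟨h1, h2⟩
      rcases Nat.lt_or_ge w s with h | h
      · exact Or.inl ⟨h1, h⟩
      · exact Or.inr ⟨h, h2⟩
    · rintro (⟨h1, h2⟩ | ⟨h1, h2⟩)
      · exact ⟨h1, by omega⟩
      · exact ⟨he w h1 h2, h2⟩
  rw [overlap, this, Finset.card_union_of_disjoint, overlap, Nat.card_Ico]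
  rw [Finset.disjoint_left]
  intro w hw hw'
  simp only [Finset.mem_filter, Finset.mem_Ico] at hw hw'
  omega

theorem overlap_gap {X Y : Finset ℕ} {s e : ℕ} (hse : s ≤ e)
    (he : ∀ z, s ≤ z → z < e → ¬(z ∈ X ∧ z ∈ Y)) : overlap X Y e = overlap X Y s := by
  have : (X ∩ Y).filter (· < e) = (X ∩ Y).filter (· < s) := by
    ext w
    simp only [Finset.mem_filter, Finset.mem_inter]
    constructor
    · rintro ⟨h1, h2⟩
      refine ⟨h1, ?_⟩
      by_contra h
      exact he w (by omega) h2 h1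
    · rintro ⟨h1, h2⟩
      exact ⟨h1, by omega⟩
  rw [overlap, this, overlap]

/-- The state of the scan from the left when an overlap of a block of `X` and a block of `Y` begins
at `s`. The block of `X` has met `k` blocks of `Y` before, of which parts of total size `σ` are
charged to it; `A` is the size of a common part that avoids it, `A + y` the size of one that need
not do so. -/
def ScanState (p c R : ℕ) (X Y : Finset ℕ) (s : ℕ) : Prop :=
  ∃ A k σ y b : ℕ, HasCommonAvoiding X Y s A ∧ HasCommon X Y s (A + y) ∧ σ ≤ k * y ∧
    (∀ z, b ≤ z → z < s → z ∈ X) ∧ b + (σ + k * p) ≤ s ∧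
    R * overlap X Y s + c * (σ + k * p) ≤ c * s + R * (σ + 2 * A) ∧
    (∀ z, z + 1 = s → z ∉ Y)

/-- Induction on the distance from `s` to `n`, one overlap at a time. `hstar` says that a block with
`k + 1` overlaps of total size `σ`, of which `y` is kept, pays for its cost `σ - 2y` at the rate `c
/ R` per letter of its length. The inequality in `ScanState` keeps the account of all earlier blocks
settled, while the current block is still open with `σ` positions and length `σ + k * p` in reserve.
-/
theorem exists_hasCommon_of_scanState {p r c R n : ℕ}
    (hstar : ∀ k σ y, σ ≤ (k + 1) * y → σ + k * p ≤ r → σ + k * p ≤ n →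
      R * σ ≤ 2 * (R * y) + c * (σ + k * p)) (d : ℕ) :
    ∀ (s : ℕ) (X Y : Finset ℕ), n - s ≤ d → Code p r X → Code p r Y → (∀ x ∈ X, x < n) →
      (∀ y ∈ Y, y < n) → s ∈ X → s ∈ Y → ScanState p c R X Y s →
      ∃ A, HasCommon X Y n A ∧ R * overlap X Y n ≤ c * n + 2 * (R * A) := by
  classical
  induction d with
  | zero =>
    intro s X Y hd _ _ hXn _ hsX
    have := hXn s hsX
    omega
  | succ d ih =>
    rintro s X Y hd hX hY hXn hYn hsX hsY ⟨A, k, σ, y, b, hA, hAy, hσ, hb, hbs, hT, hpred⟩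
    have hsn := hXn s hsX
    have hex : ∃ e, s < e ∧ ¬(e ∈ X ∧ e ∈ Y) := ⟨n, hsn, fun h => absurd (hXn n h.1) (by omega)⟩
    obtain ⟨hse, heXY⟩ := Nat.find_spec hex
    have hemin := fun m (hm : m < Nat.find hex) => Nat.find_min hex hm
    set e := Nat.find hex
    have hrun : ∀ z, s ≤ z → z < e → z ∈ X ∧ z ∈ Y := by
      intro z h1 h2
      rcases Nat.eq_or_lt_of_le h1 with h | h
      · exact h ▸ ⟨hsX, hsY⟩
      · by_contra hz
        exact hemin z h2 ⟨h, hz⟩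
    have hen : e ≤ n := by
      by_contra h
      exact absurd (hXn n (hrun n hsn.le (by omega)).1) (by omega)
    have hTe := overlap_run hse.le hrun
    have hbX : ∀ z, b ≤ z → z < e → z ∈ X := fun z h1 h2 => by
      rcases Nat.lt_or_ge z s with h | h
      · exact hb z h1 h
      · exact (hrun z h h2).1
    have hlen := hX.length_le hbX
    obtain ⟨o, ho⟩ : ∃ o, e = s + o := ⟨e - s, by omega⟩
    have hos : e - s = o := by omega
    -- Of the overlaps with the current block of `X` only one piece can be kept: either the old
    -- choice of gain `y` or the new overlap of size `o`.
    have hbest : HasCommon X Y e (A + max y o) := by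
      rcases le_total y o with h | h
      · rw [max_eq_right h, ← hos]
        exact hA.extend hpred hse.le hrun
      · rw [max_eq_left h]
        exact hAy.mono hse.le
    have hkmax : σ + o ≤ (k + 1) * max y o := by
      have h1 : k * y ≤ k * max y o := Nat.mul_le_mul_left _ (le_max_left _ _)
      have h2 : o ≤ max y o := le_max_right _ _
      rw [add_mul, one_mul]
      omega
    rw [hos] at hTe
    -- The account if the current block is closed at `e`.
    have hclosed : R * overlap X Y e ≤ c * e + 2 * (R * (A + max y o)) := by
      have h1 := hstar k (σ + o) (max y o) hkmax (by omega) (by omega)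
      rw [hTe, ho]
      linarith
    by_cases hnext : ∃ s', e ≤ s' ∧ s' ∈ X ∧ s' ∈ Y
    · obtain ⟨hes, hsX', hsY'⟩ := Nat.find_spec hnext
      have hsmin := fun m (hm : m < Nat.find hnext) => Nat.find_min hnext hm
      set s' := Nat.find hnext
      have hes' : e < s' := by
        rcases Nat.eq_or_lt_of_le hes with h | h
        · exact absurd ⟨h ▸ hsX', h ▸ hsY'⟩ heXY
        · exact h
      have hgap : ∀ z, e ≤ z → z < s' → ¬(z ∈ X ∧ z ∈ Y) := fun z h1 h2 h3 => hsmin z h2 ⟨h1, h3⟩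
      have hTs := overlap_gap hes hgap
      have hlast := hrun (e - 1) (by omega) (by omega)
      -- The same block of `X` reaches the next overlap, so it stays open; the gap of `Y` between
      -- the two overlaps adds `p` to its length.
      by_cases hlinkX : ∀ z, e ≤ z → z < s' → z ∈ X
      · have hYgap : ∀ z, e ≤ z → z < s' → z ∉ Y := fun z h1 h2 h3 =>
          hgap z h1 h2 ⟨hlinkX z h1 h2, h3⟩
        have hp := hY.2 (e - 1) s' (by omega) hlast.2 hsY' fun z h1 h2 => hYgap z (by omega) h2
        refine ih s' X Y (by omega) hX hY hXn hYn hsX' hsY'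
          ⟨A, k + 1, σ + o, max y o, b, hA.mono (by omega), hbest.mono hes, hkmax, ?_, ?_, ?_, ?_⟩
        · intro z h1 h2
          rcases Nat.lt_or_ge z e with h | h
          · exact hbX z h1 h
          · exact hlinkX z h h2
        · rw [add_mul]; omega
        · rw [hTs, hTe]
          have : c * (s + o + p) ≤ c * s' := Nat.mul_le_mul_left _ (by omega)
          linarith
        · intro z hz
          exact hYgap z (by omega) (by omega)
      -- Now the block of `Y` reaches the next overlap and the roles are exchanged. The overlap of
      -- size `o` belongs to both blocks: `min y o` is charged to the old block of `X`, which is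
      -- closed, and the rest `ρ` to the block of `Y`. The choice that skips this overlap avoids the
      -- block of `Y`, and taking it instead gains exactly `ρ`.
      · by_cases hlinkY : ∀ z, e ≤ z → z < s' → z ∈ Y
        · have hXgap : ∀ z, e ≤ z → z < s' → z ∉ X := fun z h1 h2 h3 =>
            hgap z h1 h2 ⟨h3, hlinkY z h1 h2⟩
          have hp := hX.2 (e - 1) s' (by omega) hlast.1 hsX' fun z h1 h2 => hXgap z (by omega) h2
          have hstar' := hstar k (σ + min y o) y (by
            have : min y o ≤ y := min_le_left _ _
            rw [add_mul, one_mul]; omega) (by omega) (by omega)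
          have hav : HasCommonAvoiding Y X s' (A + y) :=
            (hAy.symm_avoiding_of_pred hpred).mono (by omega)
          have hco : HasCommon Y X s' (A + y + (o - min y o)) := by
            have := (hbest.mono hes).symm
            rwa [show A + y + (o - min y o) = A + max y o by omega]
          obtain ⟨ρ, hρ⟩ : ∃ ρ, o = min y o + ρ := ⟨o - min y o, by omega⟩
          rw [show o - min y o = ρ by omega] at hco
          suffices hst : ScanState p c R Y X s' by
            obtain ⟨B, hB, hB'⟩ := ih s' Y X (by omega) hY hX hYn hXn hsY' hsX' hst
            exact ⟨B, hB.symm, by rwa [overlap_comm] at hB'⟩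
          refine ⟨A + y, 1, ρ, ρ, s, hav, hco, by omega, ?_, by omega, ?_, ?_⟩
          · intro z h1 h2
            rcases Nat.lt_or_ge z e with h | h
            · exact (hrun z h1 h).2
            · exact hlinkY z h h2
          · rw [overlap_comm, hTs, hTe]
            have : c * (s + (min y o + ρ) + p) ≤ c * s' := Nat.mul_le_mul_left _ (by omega)
            generalize min y o = μ at *
            subst hρ
            linarith
          · intro z hz
            exact hXgap z (by omega) (by omega)
        -- Both blocks end before `s'`, so the scan restarts with an empty account. One of the codes
        -- has a block that starts at `s'`, and this code is taken as the second one.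
        · push Not at hlinkX hlinkY
          obtain ⟨x, hx1, hx2, hx3⟩ := hlinkX
          obtain ⟨x', hx1', hx2', hx3'⟩ := hlinkY
          have hcs : c * e ≤ c * s' := Nat.mul_le_mul_left _ hes
          by_cases hpY : ∀ z, z + 1 = s' → z ∉ Y
          · refine ih s' X Y (by omega) hX hY hXn hYn hsX' hsY'
              ⟨A + max y o, 0, 0, 0, s', hbest.avoiding hx1 hx2 hx3, hbest.mono hes, by omega,
                fun z h1 h2 => by omega, by omega, ?_, hpY⟩
            rw [hTs]
            linarith
          · push Not at hpY
            obtain ⟨w, hw1, hw2⟩ := hpY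
            suffices hst : ScanState p c R Y X s' by
              obtain ⟨B, hB, hB'⟩ := ih s' Y X (by omega) hY hX hYn hXn hsY' hsX' hst
              exact ⟨B, hB.symm, by rwa [overlap_comm] at hB'⟩
            refine ⟨A + max y o, 0, 0, 0, s', hbest.symm.avoiding hx1' hx2' hx3',
                (hbest.mono hes).symm, by omega, fun z h1 h2 => by omega, by omega, ?_, ?_⟩
            · rw [overlap_comm, hTs]
              linarith
            · rintro z hz hzX
              exact hgap z (by omega) (by omega) ⟨hzX, (show w = z by omega) ▸ hw2⟩
    · refine ⟨A + max y o, hbest.mono hen, ?_⟩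
      rw [overlap_gap hen fun z h1 _ h3 => hnext ⟨z, h1, h3⟩]
      have : c * e ≤ c * n := Nat.mul_le_mul_left _ hen
      omega

/-- Two codes have a large common part that is convex in the blocks of both, if single blocks
satisfy the corresponding inequality. -/
theorem exists_large_common {p r c R n : ℕ}
    (hstar : ∀ k σ y, σ ≤ (k + 1) * y → σ + k * p ≤ r → σ + k * p ≤ n →
      R * σ ≤ 2 * (R * y) + c * (σ + k * p)) {X Y : Finset ℕ} (hX : Code p r X) (hY : Code p r Y)
    (hXn : ∀ x ∈ X, x < n) (hYn : ∀ y ∈ Y, y < n) :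
    ∃ W, W ⊆ X ∧ W ⊆ Y ∧ ConvIn W X ∧ ConvIn W Y ∧
      R * (X.card + Y.card) ≤ R * (n + 2 * W.card) + c * n := by
  classical
  have hunion : (X ∪ Y).card ≤ n := by
    have : X ∪ Y ⊆ Finset.range n := by
      intro x hx
      rcases Finset.mem_union.1 hx with h | h
      · exact Finset.mem_range.2 (hXn x h)
      · exact Finset.mem_range.2 (hYn x h)
    simpa using Finset.card_le_card this
  have hadd := Finset.card_union_add_card_inter X Y
  -- `|X| + |Y| = |X ∪ Y| + |X ∩ Y|` with `|X ∪ Y| ≤ n`, so only the overlap has to be compared with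
  -- the common part.
  suffices h : ∃ A, HasCommon X Y n A ∧ R * overlap X Y n ≤ c * n + 2 * (R * A) by
    obtain ⟨A, ⟨W, h1, h2, h3, h4⟩, h5⟩ := h
    refine ⟨W, fun w hw => (h1 w hw).1, fun w hw => (h1 w hw).2.1, h2, h3, ?_⟩
    have ho : overlap X Y n = (X ∩ Y).card := by
      rw [overlap, Finset.filter_true_of_mem]
      exact fun x hx => hXn x (Finset.mem_inter.1 hx).1
    rw [ho] at h5
    have h6 : R * A ≤ R * W.card := Nat.mul_le_mul_left _ h4
    have h7 : R * (X ∪ Y).card ≤ R * n := Nat.mul_le_mul_left _ hunion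
    rw [← hadd]
    linarith
  have hempty : ∀ m, HasCommon X Y m 0 := fun m =>
    ⟨∅, by simp, fun a b c h => by simp at h, fun a b c h => by simp at h, by simp⟩
  by_cases hne : ∃ s, s ∈ X ∧ s ∈ Y
  · obtain ⟨hsX, hsY⟩ := Nat.find_spec hne
    have hsmin := fun m (hm : m < Nat.find hne) => Nat.find_min hne hm
    set s := Nat.find hne
    have hT : overlap X Y s = 0 := by
      rw [overlap_gap (Nat.zero_le s) fun z _ h2 => hsmin z h2]
      simp [overlap]
    have hav : HasCommonAvoiding X Y s 0 :=
      ⟨∅, by simp, fun a b c h => by simp at h, fun a b c h => by simp at h, by simp, by simp⟩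
    by_cases hpY : ∀ z, z + 1 = s → z ∉ Y
    · exact exists_hasCommon_of_scanState hstar _ s X Y le_rfl hX hY hXn hYn hsX hsY
        ⟨0, 0, 0, 0, s, hav, hempty s, by omega, fun z _ _ => by omega, by omega, by simp [hT], hpY⟩
    · push Not at hpY
      obtain ⟨w, hw1, hw2⟩ := hpY
      have hav' : HasCommonAvoiding Y X s 0 :=
        ⟨∅, by simp, fun a b c h => by simp at h, fun a b c h => by simp at h, by simp, by simp⟩
      obtain ⟨B, hB, hB'⟩ := exists_hasCommon_of_scanState hstar _ s Y X le_rfl hY hX hYn hXn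
        hsY hsX ⟨0, 0, 0, 0, s, hav', (hempty s).symm, by omega, fun z _ _ => by omega, by omega,
          by simp [overlap_comm Y X, hT],
          fun z hz hzX => hsmin z (by omega) ⟨hzX, (show w = z by omega) ▸ hw2⟩⟩
      exact ⟨B, hB.symm, by rwa [overlap_comm] at hB'⟩
  · refine ⟨0, hempty n, ?_⟩
    rw [overlap_gap (Nat.zero_le n) fun z _ _ h => hne ⟨z, h⟩]
    simp [overlap]


/-! ### Words, walks and the diameter -/

/-- The support of a binary word. -/
def support {n : ℕ} (w : Fin n → Bool) : Finset ℕ :=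
  (Finset.univ.filter (fun i => w i = true)).map Fin.valEmbedding

theorem mem_support {n : ℕ} (w : Fin n → Bool) (i : ℕ) :
    i ∈ support w ↔ ∃ h : i < n, w ⟨i, h⟩ = true := by
  simp only [support, Finset.mem_map, Finset.mem_filter, Finset.mem_univ, true_and,
    Fin.valEmbedding_apply]
  constructor
  · rintro ⟨a, h1, rfl⟩
    exact ⟨a.2, h1⟩
  · rintro ⟨h, h1⟩
    exact ⟨⟨i, h⟩, h1, rfl⟩

theorem lt_of_mem_support {n : ℕ} {w : Fin n → Bool} {i : ℕ} (h : i ∈ support w) : i < n :=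
  ((mem_support w i).1 h).1

theorem support_injective {n : ℕ} : Function.Injective (support (n := n)) := by
  intro u v h
  funext i
  have := congrArg (fun X => i.1 ∈ X) h
  simp only [mem_support, i.2, exists_true_left, eq_iff_iff] at this
  exact Bool.eq_iff_iff.2 this

/-- The word of length `n` with support `X`. -/
def toWord (n : ℕ) (X : Finset ℕ) : Fin n → Bool := fun i => decide (i.1 ∈ X)

theorem support_toWord {n : ℕ} {X : Finset ℕ} (hX : ∀ x ∈ X, x < n) :
    support (toWord n X) = X := by
  ext i
  rw [mem_support]
  simp only [toWord, decide_eq_true_eq]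
  exact ⟨fun h => h.2, fun h => ⟨hX i h, h⟩⟩

theorem isIFibCode_iff_code {p r n : ℕ} (w : Fin n → Bool) :
    IsIFibCode p r w ↔ Code p r (support w) := by
  constructor
  · rintro ⟨h1, h2⟩
    refine ⟨fun i => ?_, fun i j hij hi hj hbet => ?_⟩
    · rcases Nat.lt_or_ge (i + r) n with h | h
      · obtain ⟨j, hj1, hj2, hj3⟩ := h1 i h
        refine ⟨j, hj1, hj2, fun hj => ?_⟩
        obtain ⟨h', hj'⟩ := (mem_support w j).1 hj
        exact absurd (hj'.symm.trans hj3) (by simp)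
      · exact ⟨i + r, by omega, le_rfl, fun hi => absurd (lt_of_mem_support hi) (by omega)⟩
    · obtain ⟨hin, hi'⟩ := (mem_support w i).1 hi
      obtain ⟨hjn, hj'⟩ := (mem_support w j).1 hj
      have := h2 ⟨i, hin⟩ ⟨j, hjn⟩ hij hi' hj' fun k hk1 hk2 => by
        have := hbet k hk1 hk2
        rw [mem_support] at this
        simpa using fun h => this ⟨k.2, h⟩
      simp only at this
      omega
  · rintro ⟨h1, h2⟩
    refine ⟨fun i hi => ?_, fun i j hij hi hj hbet => ?_⟩
    · obtain ⟨j, hj1, hj2, hj3⟩ := h1 i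
      refine ⟨⟨j, by omega⟩, hj1, hj2, ?_⟩
      rw [mem_support] at hj3
      exact Bool.eq_false_iff.2 fun h => hj3 ⟨_, h⟩
    · have := h2 i j hij ((mem_support w i).2 ⟨i.2, hi⟩) ((mem_support w j).2 ⟨j.2, hj⟩)
        fun k hk1 hk2 hk => by
          obtain ⟨hkn, hk'⟩ := (mem_support w k).1 hk
          exact absurd (hk'.symm.trans (hbet ⟨k, hkn⟩ hk1 hk2)) (by simp)
      omega

theorem hammingDist_eq_card_symmDiff {n : ℕ} (u v : Fin n → Bool) :
    hammingDist u v = (symmDiff (support u) (support v)).card := by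
  classical
  have : symmDiff (support u) (support v) =
      (Finset.univ.filter (fun i => u i ≠ v i)).map Fin.valEmbedding := by
    ext i
    simp only [Finset.mem_symmDiff, mem_support, Finset.mem_map, Finset.mem_filter,
      Finset.mem_univ, true_and, Fin.valEmbedding_apply]
    constructor
    · rintro (⟨⟨h, h1⟩, h2⟩ | ⟨⟨h, h1⟩, h2⟩)
      · exact ⟨⟨i, h⟩, fun h' => h2 ⟨h, h' ▸ h1⟩, rfl⟩
      · exact ⟨⟨i, h⟩, fun h' => h2 ⟨h, h' ▸ h1⟩, rfl⟩
    · rintro ⟨a, h1, rfl⟩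
      cases hu : u a <;> cases hv : v a <;> simp_all
  rw [this, Finset.card_map, hammingDist]

/-- The vertex of the cube with a given support. -/
def toVertex {p r n : ℕ} (X : Finset ℕ) (hX : Code p r X) (hXn : ∀ x ∈ X, x < n) :
    {w : Fin n → Bool // IsIFibCode p r w} :=
  ⟨toWord n X, (isIFibCode_iff_code _).2 (by rwa [support_toWord hXn])⟩

theorem toVertex_support {p r n : ℕ} (u : {w : Fin n → Bool // IsIFibCode p r w})
    (h : Code p r (support u.1)) :
    toVertex (support u.1) h (fun _ hx => lt_of_mem_support hx) = u :=
  Subtype.ext (support_injective (support_toWord fun _ hx => lt_of_mem_support hx))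

theorem support_toVertex {p r n : ℕ} {X : Finset ℕ} (hX : Code p r X)
    (hXn : ∀ x ∈ X, x < n) : support (toVertex X hX hXn).1 = X :=
  support_toWord hXn

theorem adj_toVertex_erase {p r n : ℕ} {X : Finset ℕ} (hX : Code p r X)
    (hXn : ∀ x ∈ X, x < n) {s : ℕ} (hs : s ∈ X) (hs' : Code p r (X.erase s)) :
    (IFibCube p r n).Adj (toVertex X hX hXn)
      (toVertex (X.erase s) hs' fun x hx => hXn x (Finset.mem_of_mem_erase hx)) := by
  classical
  change hammingDist (toWord n X) (toWord n (X.erase s)) = 1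
  rw [hammingDist_eq_card_symmDiff, support_toWord hXn,
    support_toWord fun x hx => hXn x (Finset.mem_of_mem_erase hx), Finset.card_eq_one]
  refine ⟨s, ?_⟩
  ext i
  simp only [Finset.mem_symmDiff, Finset.mem_erase, Finset.mem_singleton]
  constructor
  · rintro (⟨h1, h2⟩ | ⟨h1, h2⟩)
    · by_contra h
      exact h2 ⟨h, h1⟩
    · exact absurd h1.2 h2
  · rintro rfl
    exact Or.inl ⟨hs, fun h => h.1 rfl⟩

theorem eq_insert_of_card_symmDiff {X Y : Finset ℕ} (h : (symmDiff X Y).card = 1) :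
    ∃ j, (j ∉ X ∧ Y = insert j X) ∨ (j ∉ Y ∧ X = insert j Y) := by
  obtain ⟨j, hj⟩ := Finset.card_eq_one.1 h
  have hiff : ∀ i, (i ∈ X ∧ i ∉ Y ∨ i ∈ Y ∧ i ∉ X) ↔ i = j := fun i => by
    rw [← Finset.mem_symmDiff, hj, Finset.mem_singleton]
  refine ⟨j, ?_⟩
  rcases (hiff j).2 rfl with ⟨h1, h2⟩ | ⟨h1, h2⟩
  · refine Or.inr ⟨h2, ?_⟩
    ext i
    have := hiff i
    rw [Finset.mem_insert]
    by_cases hi : i = j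
    · subst hi; tauto
    · tauto
  · refine Or.inl ⟨h2, ?_⟩
    ext i
    have := hiff i
    rw [Finset.mem_insert]
    by_cases hi : i = j
    · subst hi; tauto
    · tauto

/-- Erasing elements one at a time gives a walk, if a suitable property of codes is kept. -/
theorem exists_walk_of_erase {p r n : ℕ} {W : Finset ℕ} (Q : Finset ℕ → Prop)
    (hQ : ∀ X, Code p r X → W ⊆ X → Q X → W ≠ X →
      ∃ s ∈ X, s ∉ W ∧ Code p r (X.erase s) ∧ Q (X.erase s)) (d : ℕ) :
    ∀ (X : Finset ℕ) (hX : Code p r X) (hXn : ∀ x ∈ X, x < n), W ⊆ X → Q X →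
      X.card = W.card + d → ∃ (hW : Code p r W) (hWn : ∀ x ∈ W, x < n)
        (q : (IFibCube p r n).Walk (toVertex X hX hXn) (toVertex W hW hWn)),
        q.length = d := by
  classical
  induction d with
  | zero =>
    intro X hX hXn hWX _ hcard
    obtain rfl := Finset.eq_of_subset_of_card_le hWX (by omega)
    exact ⟨hX, hXn, .nil, rfl⟩
  | succ d ih =>
    intro X hX hXn hWX hQX hcard
    obtain ⟨s, hs, hsW, hs', hQs⟩ := hQ X hX hWX hQX (by rintro rfl; omega)
    obtain ⟨hW, hWn, q, hq⟩ := ih (X.erase s) hs' (fun x hx => hXn x (Finset.mem_of_mem_erase hx))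
      (fun w hw => Finset.mem_erase.2 ⟨by rintro rfl; exact hsW hw, hWX hw⟩) hQs
      (by rw [Finset.card_erase_of_mem hs]; omega)
    exact ⟨hW, hWn, .cons (adj_toVertex_erase hX hXn hs hs') q, by simp [hq]⟩

theorem exists_walk_of_convIn {p r n : ℕ} {W X : Finset ℕ} (hX : Code p r X)
    (hXn : ∀ x ∈ X, x < n) (hWX : W ⊆ X) (hc : ConvIn W X) :
    ∃ (hW : Code p r W) (hWn : ∀ x ∈ W, x < n)
      (q : (IFibCube p r n).Walk (toVertex X hX hXn) (toVertex W hW hWn)),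
      q.length + W.card = X.card := by
  obtain ⟨hW, hWn, q, hq⟩ := exists_walk_of_erase (n := n) (ConvIn W) (fun X hX hWX hc hne => by
    obtain ⟨s, h1, h2, h3⟩ := hX.exists_erase hWX hc hne
    exact ⟨s, h1, h2, h3, hc.mono (Finset.erase_subset _ _)⟩) (X.card - W.card) X hX hXn hWX hc
    (by have := Finset.card_le_card hWX; omega)
  have := Finset.card_le_card hWX
  exact ⟨hW, hWn, q, by omega⟩

theorem exists_walk_of_subset {r n : ℕ} {W X : Finset ℕ} (hX : Code 1 r X)
    (hXn : ∀ x ∈ X, x < n) (hWX : W ⊆ X) :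
    ∃ (hW : Code 1 r W) (hWn : ∀ x ∈ W, x < n)
      (q : (IFibCube 1 r n).Walk (toVertex X hX hXn) (toVertex W hW hWn)),
      q.length + W.card = X.card := by
  classical
  obtain ⟨hW, hWn, q, hq⟩ := exists_walk_of_erase (n := n) (fun _ => True)
    (fun X hX hWX _ hne => by
      obtain ⟨x, hxX, hxW⟩ : ∃ x ∈ X, x ∉ W := by
        by_contra! h
        exact hne (Finset.Subset.antisymm hWX h)
      exact ⟨x, hxX, hxW, hX.subset_of_one (Finset.erase_subset _ _), trivial⟩)
    (X.card - W.card) X hX hXn hWX trivial (by have := Finset.card_le_card hWX; omega)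
  have := Finset.card_le_card hWX
  exact ⟨hW, hWn, q, by omega⟩

/-- The empty set is convex in every code, so each word can be emptied. Connectedness keeps `diam`
from taking its default value `0`, and is needed to compare `dist` with it. -/
theorem connected_IFibCube {p r n : ℕ} : (IFibCube p r n).Connected := by
  have hempty : ∀ u : {w : Fin n → Bool // IsIFibCode p r w}, (IFibCube p r n).Reachable u
      (toVertex ∅ (code_empty p r) (by simp)) := by
    intro u
    have hu := (isIFibCode_iff_code u.1).1 u.2
    obtain ⟨_, _, q, _⟩ := exists_walk_of_convIn (n := n) hu (fun _ hx => lt_of_mem_support hx)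
      (Finset.empty_subset _) (fun a b c ha => by simp at ha)
    rw [toVertex_support] at q
    exact ⟨q⟩
  have : Nonempty {w : Fin n → Bool // IsIFibCode p r w} :=
    ⟨toVertex ∅ (code_empty p r) (by simp)⟩
  exact ⟨fun u v => (hempty u).trans (hempty v).symm⟩

theorem dist_le_diam_IFibCube {p r n : ℕ}
    (u v : {w : Fin n → Bool // IsIFibCode p r w}) :
    (IFibCube p r n).dist u v ≤ (IFibCube p r n).diam := by
  have : Nonempty {w : Fin n → Bool // IsIFibCode p r w} := ⟨u⟩
  exact SimpleGraph.dist_le_diam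
    (SimpleGraph.connected_iff_ediam_ne_top.1 (connected_IFibCube))

/-- The diameter is at most `D` if any two codes have a common part to which both can be reduced,
with at most `D` steps in total. -/
theorem diam_le_of_common {p r n D : ℕ}
    (h : ∀ X Y, Code p r X → Code p r Y → (∀ x ∈ X, x < n) → (∀ y ∈ Y, y < n) →
      ∃ W, W ⊆ X ∧ W ⊆ Y ∧ (p = 1 ∨ ConvIn W X ∧ ConvIn W Y) ∧
        X.card + Y.card ≤ D + 2 * W.card) : (IFibCube p r n).diam ≤ D := by
  have : Nonempty {w : Fin n → Bool // IsIFibCode p r w} :=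
    ⟨toVertex ∅ (code_empty p r) (by simp)⟩
  obtain ⟨u, v, huv⟩ := (IFibCube p r n).exists_dist_eq_diam
  rw [← huv]
  have hu := (isIFibCode_iff_code u.1).1 u.2
  have hv := (isIFibCode_iff_code v.1).1 v.2
  obtain ⟨W, hWX, hWY, hc, hcard⟩ := h _ _ hu hv (fun _ hx => lt_of_mem_support hx)
    (fun _ hx => lt_of_mem_support hx)
  have hwalk : ∀ X (hX : Code p r X) (hXn : ∀ x ∈ X, x < n), W ⊆ X → (p = 1 ∨ ConvIn W X) →
      ∃ (hW : Code p r W) (hWn : ∀ x ∈ W, x < n)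
        (q : (IFibCube p r n).Walk (toVertex X hX hXn) (toVertex W hW hWn)),
        q.length + W.card = X.card := by
    clear hWX hWY
    rintro X hX hXn hWX (rfl | hc)
    · exact exists_walk_of_subset hX hXn ‹_›
    · exact exists_walk_of_convIn hX hXn ‹_› hc
  obtain ⟨_, _, q, hq⟩ := hwalk _ hu (fun _ hx => lt_of_mem_support hx) hWX (hc.imp_right And.left)
  obtain ⟨_, _, q', hq'⟩ := hwalk _ hv (fun _ hx => lt_of_mem_support hx) hWY
    (hc.imp_right And.right)
  have hle := SimpleGraph.dist_le (q.append q'.reverse)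
  rw [SimpleGraph.Walk.length_append, SimpleGraph.Walk.length_reverse] at hle
  replace hle := hle.trans (show q.length + q'.length ≤ D by omega)
  rwa [toVertex_support, toVertex_support] at hle

/-! ### Lipschitz functions of codes -/

/-- A function of codes that changes by at most one if an element of `S` is inserted, and does not
change if another element is inserted. -/
def LipOn (p r : ℕ) (S : Finset ℕ) (f : Finset ℕ → ℤ) : Prop :=
  ∀ X j, j ∉ X → Code p r X → Code p r (insert j X) →
    |f (insert j X) - f X| ≤ if j ∈ S then 1 else 0

/-- An inserted letter lies in at most one of `S` and `T`, so at most one summand changes. -/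
theorem LipOn.add {p r : ℕ} {S T : Finset ℕ} {f g : Finset ℕ → ℤ} (hf : LipOn p r S f)
    (hg : LipOn p r T g) (hST : Disjoint S T) : LipOn p r (S ∪ T) (fun X => f X + g X) := by
  intro X j hj hX hX'
  have h1 := hf X j hj hX hX'
  have h2 := hg X j hj hX hX'
  have h3 : |f (insert j X) + g (insert j X) - (f X + g X)| ≤
      |f (insert j X) - f X| + |g (insert j X) - g X| := by
    rw [show f (insert j X) + g (insert j X) - (f X + g X) =
      (f (insert j X) - f X) + (g (insert j X) - g X) by ring]
    exact abs_add_le _ _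
  refine h3.trans ((add_le_add h1 h2).trans ?_)
  by_cases hS : j ∈ S
  · have hT := Finset.disjoint_left.1 hST hS
    simp [hS, hT]
  · simp [hS]

/-- Along a shortest walk from `X` to `Y` each step raises `f` by at most one. -/
theorem LipOn.le_diam {p r n : ℕ} {S : Finset ℕ} {f : Finset ℕ → ℤ}
    (hf : LipOn p r S f) {X Y : Finset ℕ} (hX : Code p r X) (hY : Code p r Y)
    (hXn : ∀ x ∈ X, x < n) (hYn : ∀ y ∈ Y, y < n) :
    f Y - f X ≤ (IFibCube p r n).diam := by
  classical
  have hwalk : ∀ (u v : {w : Fin n → Bool // IsIFibCode p r w}) (q : (IFibCube p r n).Walk u v),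
      f (support v.1) - f (support u.1) ≤ q.length := by
    intro u v q
    induction q with
    | nil => simp
    | @cons u v w h q ih =>
      have hu := (isIFibCode_iff_code u.1).1 u.2
      have hv := (isIFibCode_iff_code v.1).1 v.2
      have hstep : |f (support v.1) - f (support u.1)| ≤ 1 := by
        have hif : ∀ j, (if j ∈ S then (1 : ℤ) else 0) ≤ 1 := fun j => by split_ifs <;> simp
        change hammingDist u.1 v.1 = 1 at h
        rw [hammingDist_eq_card_symmDiff] at h
        obtain ⟨j, ⟨hj, he⟩ | ⟨hj, he⟩⟩ := eq_insert_of_card_symmDiff h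
        · rw [he]
          exact (hf _ j hj hu (he ▸ hv)).trans (hif j)
        · rw [he, abs_sub_comm]
          exact (hf _ j hj hv (he ▸ hu)).trans (hif j)
      have := (abs_le.1 hstep).2
      rw [SimpleGraph.Walk.length_cons]
      push_cast
      linarith
  obtain ⟨q, hq⟩ := (connected_IFibCube).exists_walk_length_eq_dist
    (toVertex X hX hXn) (toVertex Y hY hYn)
  have h1 := hwalk _ _ q
  have h2 := dist_le_diam_IFibCube (toVertex X hX hXn) (toVertex Y hY hYn)
  rw [support_toVertex, support_toVertex, hq] at h1
  exact h1.trans (by exact_mod_cast h2)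


theorem lipOn_card (p r : ℕ) (S : Finset ℕ) : LipOn p r S (fun X => ((X ∩ S).card : ℤ)) := by
  intro X j hj _ _
  by_cases h : j ∈ S
  · simp [h, Finset.insert_inter_of_mem, hj]
  · simp [h, Finset.insert_inter_of_notMem]

theorem LipOn.neg {p r : ℕ} {S : Finset ℕ} {f : Finset ℕ → ℤ} (hf : LipOn p r S f) :
    LipOn p r S (fun X => -f X) := by
  intro X j hj hX hX'
  have := hf X j hj hX hX'
  rwa [show -f (insert j X) - -f X = -(f (insert j X) - f X) by ring, abs_neg]

open Classical in
/-- The largest number of consecutive elements of `X` in the interval `[s, e)`. -/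
noncomputable def maxRun (X : Finset ℕ) (s e : ℕ) : ℕ :=
  Nat.findGreatest (fun l => ∃ i, s ≤ i ∧ i + l ≤ e ∧ ∀ z, i ≤ z → z < i + l → z ∈ X) e

theorem le_maxRun {X : Finset ℕ} {s e i l : ℕ} (hi : s ≤ i) (hl : i + l ≤ e)
    (h : ∀ z, i ≤ z → z < i + l → z ∈ X) : l ≤ maxRun X s e := by
  classical
  exact Nat.le_findGreatest (by omega) ⟨i, hi, hl, h⟩

theorem exists_maxRun {X : Finset ℕ} {s e : ℕ} (hse : s ≤ e) :
    ∃ i, s ≤ i ∧ i + maxRun X s e ≤ e ∧ ∀ z, i ≤ z → z < i + maxRun X s e → z ∈ X := by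
  classical
  exact Nat.findGreatest_spec (m := 0) (n := e)
    (P := fun l => ∃ i, s ≤ i ∧ i + l ≤ e ∧ ∀ z, i ≤ z → z < i + l → z ∈ X) (Nat.zero_le _)
    ⟨s, le_rfl, by omega, fun z h1 h2 => by omega⟩

/-- If the new letter were inside a run, it would have filled a gap of length one, which `2 ≤ p`
forbids. So it is at an end of the run or outside, and dropping one end letter leaves a run of `X`.
-/
theorem maxRun_insert_le {p r : ℕ} (hp : 2 ≤ p) {X : Finset ℕ} {s e j : ℕ} (hse : s ≤ e)
    (hj : j ∉ X) (hX : Code p r X) :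
    maxRun (insert j X) s e ≤ maxRun X s e + 1 := by
  obtain ⟨i, hi, hie, h⟩ := exists_maxRun (X := insert j X) hse
  set l := maxRun (insert j X) s e
  have h' : ∀ z, i ≤ z → z < i + l → z ≠ j → z ∈ X := fun z h1 h2 h3 =>
    (Finset.mem_insert.1 (h z h1 h2)).resolve_left h3
  rcases Nat.lt_or_ge i j with hij | hij
  · rcases Nat.lt_or_ge (j + 1) (i + l) with hjl | hjl
    · have := hX.2 (j - 1) (j + 1) (by omega) (h' _ (by omega) (by omega) (by omega))
        (h' _ (by omega) (by omega) (by omega)) fun k h1 h2 => by rwa [show k = j by omega]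
      omega
    · have := le_maxRun (X := X) (l := l - 1) hi (by omega : i + (l - 1) ≤ e)
        fun z h1 h2 => h' z h1 (by omega) (by omega)
      omega
  · have : l - 1 ≤ maxRun X s e := by
      rcases Nat.eq_zero_or_pos l with h0 | h0
      · omega
      · exact le_maxRun (i := i + 1) (by omega) (by omega)
          fun z h1 h2 => h' z (by omega) (by omega) (by omega)
    omega

theorem maxRun_le_insert {X : Finset ℕ} {s e : ℕ} (j : ℕ) (hse : s ≤ e) :
    maxRun X s e ≤ maxRun (insert j X) s e := by
  obtain ⟨i, hi, hie, h⟩ := exists_maxRun (X := X) hse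
  exact le_maxRun hi hie fun z h1 h2 => Finset.mem_insert_of_mem (h z h1 h2)

theorem maxRun_insert_of_notMem {X : Finset ℕ} {s e j : ℕ} (hse : s ≤ e)
    (hj : j ∉ Finset.Ico s e) : maxRun (insert j X) s e = maxRun X s e := by
  refine le_antisymm ?_ (maxRun_le_insert j hse)
  obtain ⟨i, hi, hie, h⟩ := exists_maxRun (X := insert j X) hse
  refine le_maxRun hi hie fun z h1 h2 => (Finset.mem_insert.1 (h z h1 h2)).resolve_left ?_
  rintro rfl
  exact hj (Finset.mem_Ico.2 ⟨by omega, by omega⟩)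

/-- Blocks cannot be merged or split by single steps if `2 ≤ p`. -/
theorem lipOn_card_sub_two_mul_maxRun {p : ℕ} (hp : 2 ≤ p) (r : ℕ) {s e : ℕ} (hse : s ≤ e) :
    LipOn p r (Finset.Ico s e)
      (fun X => ((X ∩ Finset.Ico s e).card : ℤ) - 2 * (maxRun X s e : ℤ)) := by
  intro X j hj hX _
  by_cases h : j ∈ Finset.Ico s e
  · have h1 := maxRun_insert_le hp hse hj hX
    have h2 := maxRun_le_insert (X := X) j hse
    have h3 : (insert j X ∩ Finset.Ico s e).card = (X ∩ Finset.Ico s e).card + 1 := by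
      rw [Finset.insert_inter_of_mem h, Finset.card_insert_of_notMem (by simp [hj])]
    rw [if_pos h]
    beta_reduce
    -- The cardinality grows by one and `2 * maxRun` by zero or two, so the difference changes by
    -- exactly `1` or `-1`.
    rw [h3, abs_le]
    push_cast
    constructor <;> omega
  · rw [if_neg h]
    beta_reduce
    rw [Finset.insert_inter_of_notMem h, maxRun_insert_of_notMem hse h]
    simp

/-! ### Pairs of distant codes -/

theorem code_Ico (p : ℕ) {r a b : ℕ} (h : b ≤ a + r) : Code p r (Finset.Ico a b) := by
  rcases Nat.lt_or_ge b a with hab | hab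
  · rw [Finset.Ico_eq_empty (by omega)]
    exact code_empty p r
  · have := (code_empty p r).prepend (a := a) (l := b - a) (z := b) (by simp) (by simp) (by simp)
      (by omega) h
    rwa [Finset.union_empty, show a + (b - a) = b by omega] at this

theorem exists_disjoint_codes {p r m : ℕ} (hp : 1 ≤ p) (hm : 1 ≤ m) (hmp : m ≤ p) (hmr : m ≤ r)
    {j : ℕ} (hj : j < p + m) (q : ℕ) :
    ∀ a, ∃ U V : Finset ℕ, Code p r U ∧ Code p r V ∧ Disjoint U V ∧
      (∀ x ∈ U, a ≤ x ∧ x < a + (q * (p + m) + j)) ∧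
      (∀ x ∈ V, a + m ≤ x ∧ x < a + (q * (p + m) + j)) ∧
      q * (2 * m) + min j (2 * m) ≤ U.card + V.card := by
  induction q with
  | zero =>
    intro a
    refine ⟨Finset.Ico a (a + min j m), Finset.Ico (a + m) (a + min j (2 * m)),
      code_Ico p (by omega), code_Ico p (by omega), ?_, ?_, ?_, ?_⟩
    · rw [Finset.disjoint_left]
      intro x h1 h2
      simp only [Finset.mem_Ico] at h1 h2
      omega
    · intro x hx
      simp only [Finset.mem_Ico] at hx
      omega
    · intro x hx
      simp only [Finset.mem_Ico] at hx
      omega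
    · simp only [Nat.card_Ico]
      omega
  | succ q ih =>
    intro a
    obtain ⟨U, V, hU, hV, hd, hU', hV', hcard⟩ := ih (a + (p + m))
    have hq : (q + 1) * (p + m) = q * (p + m) + (p + m) := by ring
    refine ⟨Finset.Ico a (a + m) ∪ U, Finset.Ico (a + m) (a + m + m) ∪ V,
      hU.prepend (z := a + m) (fun x hx => ?_) (Or.inr fun x hx => ?_) (fun h => ?_) le_rfl
        (by omega),
      hV.prepend (z := a + m + m) (fun x hx => ?_) (Or.inr fun x hx => ?_) (fun h => ?_) le_rfl
        (by omega), ?_, ?_, ?_, ?_⟩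
    · have := hU' x hx; omega
    · have := hU' x hx; omega
    · have := hU' _ h; omega
    · have := hV' x hx; omega
    · have := hV' x hx; omega
    · have := hV' _ h; omega
    · rw [Finset.disjoint_left]
      intro x h1 h2
      simp only [Finset.mem_union, Finset.mem_Ico] at h1 h2
      rcases h1 with h1 | h1
      · rcases h2 with h2 | h2
        · omega
        · have := hV' x h2; omega
      · rcases h2 with h2 | h2
        · have := hU' x h1; omega
        · exact Finset.disjoint_left.1 hd h1 h2
    · intro x hx
      simp only [Finset.mem_union, Finset.mem_Ico] at hx
      rcases hx with hx | hx
      · omega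
      · have := hU' x hx; omega
    · intro x hx
      simp only [Finset.mem_union, Finset.mem_Ico] at hx
      rcases hx with hx | hx
      · omega
      · have := hV' x hx; omega
    · rw [Finset.card_union_of_disjoint, Finset.card_union_of_disjoint]
      · simp only [Nat.card_Ico]
        have : (q + 1) * (2 * m) = q * (2 * m) + 2 * m := by ring
        omega
      all_goals
        rw [Finset.disjoint_left]
        intro x h1 h2
        simp only [Finset.mem_Ico] at h1
      · have := hV' x h2; omega
      · have := hU' x h2; omega

/-- The test function is `|X ∩ V| - |X ∩ U|`. The choice `m = r` is used for `r < p`, and `m = p`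
gives the bound `n` for `p ≤ r`. -/
theorem two_mul_blocks_le_diam {p r m : ℕ} (hp : 1 ≤ p) (hm : 1 ≤ m) (hmp : m ≤ p) (hmr : m ≤ r)
    (n : ℕ) :
    (n / (p + m)) * (2 * m) + min (n % (p + m)) (2 * m) ≤ (IFibCube p r n).diam := by
  obtain ⟨U, V, hU, hV, hd, hU', hV', hcard⟩ := exists_disjoint_codes hp hm hmp hmr
    (Nat.mod_lt n (by omega : 0 < p + m)) (n / (p + m)) 0
  have hn : n / (p + m) * (p + m) + n % (p + m) = n := Nat.div_add_mod' n (p + m)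
  rw [hn] at hU' hV'
  have := ((lipOn_card p r V).add (lipOn_card p r U).neg hd.symm).le_diam (n := n) hU hV
    (fun x hx => by have := hU' x hx; omega) (fun x hx => by have := hV' x hx; omega)
  simp only [Finset.inter_self, Finset.disjoint_iff_inter_eq_empty.1 hd,
    Finset.disjoint_iff_inter_eq_empty.1 hd.symm, Finset.card_empty] at this
  have h2 : (U.card + V.card : ℤ) ≤ (IFibCube p r n).diam := by
    refine le_trans (le_of_eq ?_) this
    push_cast
    ring
  have h3 : U.card + V.card ≤ (IFibCube p r n).diam := by exact_mod_cast h2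
  omega

/-- A pattern of `k` blocks with lengths at most `y`, total length `σ`, and gaps of length `p`,
followed by a bridge of length `p` that merges the last of these blocks with the first block of
`X`. -/
theorem exists_pattern {p r y : ℕ} (hp : 1 ≤ p) (hy : 2 * y + p ≤ r) {X : Finset ℕ}
    (hX : Code p r X) {b : ℕ} (hXb : ∀ x ∈ X, b ≤ x) (hg : b ∈ X ∨ ∀ x ∈ X, b + p ≤ x)
    (hz : ∃ z, z ∉ X ∧ b ≤ z ∧ z ≤ b + y) (k : ℕ) :
    ∀ a σ, k + 1 ≤ σ → σ ≤ (k + 1) * y → a + (σ + k * p) + p = b →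
      ∃ V : Finset ℕ, (∀ x ∈ V, a ≤ x ∧ x < a + (σ + k * p)) ∧ a ∈ V ∧ V.card = σ ∧
        (∀ i l, (∀ z, i ≤ z → z < i + l → z ∈ V) → l ≤ y) ∧
        Code p r (V ∪ (Finset.Ico (a + (σ + k * p)) b ∪ X)) := by
  induction k with
  | zero =>
    intro a σ h1 h2 hb
    rw [zero_mul, add_zero] at *
    obtain ⟨z, hz1, hz2, hz3⟩ := hz
    refine ⟨Finset.Ico a (a + σ), fun x hx => Finset.mem_Ico.1 hx,
      Finset.mem_Ico.2 ⟨le_rfl, by omega⟩, by simp, fun i l h => ?_, ?_⟩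
    · rcases Nat.eq_zero_or_pos l with h0 | h0
      · omega
      · have h3 := Finset.mem_Ico.1 (h i le_rfl (by omega))
        have h4 := Finset.mem_Ico.1 (h (i + (l - 1)) (by omega) (by omega))
        omega
    -- The last block, the bridge and the start of `X` form one block of length at most `y + p + y ≤
    -- r`.
    · have hb' : b = a + (σ + p) := by omega
      rw [← Finset.union_assoc, Finset.Ico_union_Ico_eq_Ico (by omega) (by omega), hb']
      exact hX.prepend (z := z) (fun x hx => by have := hXb x hx; omega)
        (by rwa [← hb']) hz1 (by omega) (by omega)
  | succ k ih =>
    intro a σ h1 h2 hb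
    have hk : (k + 1) * p = k * p + p := by ring
    have hky : (k + 1 + 1) * y = (k + 1) * y + y := by ring
    have hy1 : 1 ≤ y := by
      rcases Nat.eq_zero_or_pos y with h | h
      · subst h; omega
      · exact h
    have hky' : k + 1 ≤ (k + 1) * y := Nat.le_mul_of_pos_right _ hy1
    -- The first block is as long as possible, subject to leaving one letter for each of the `k + 1`
    -- later blocks.
    obtain ⟨o, ho⟩ : ∃ o, o = min y (σ - (k + 1)) := ⟨_, rfl⟩
    obtain ⟨V, hV1, hV2, hV3, hV4, hV5⟩ := ih (a + o + p) (σ - o) (by omega) (by omega) (by omega)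
    have hend : a + o + p + (σ - o + k * p) = a + (σ + (k + 1) * p) := by omega
    rw [hend] at hV1 hV5
    have hge : ∀ x ∈ V ∪ (Finset.Ico (a + (σ + (k + 1) * p)) b ∪ X), a + o + p ≤ x := by
      intro x hx
      simp only [Finset.mem_union, Finset.mem_Ico] at hx
      rcases hx with hx | hx | hx
      · exact (hV1 x hx).1
      · omega
      · have := hXb x hx; omega
    refine ⟨Finset.Ico a (a + o) ∪ V, fun x hx => ?_, ?_, ?_, fun i l h => ?_, ?_⟩
    · simp only [Finset.mem_union, Finset.mem_Ico] at hx
      rcases hx with hx | hx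
      · omega
      · have := hV1 x hx; omega
    · exact Finset.mem_union_left _ (Finset.mem_Ico.2 ⟨le_rfl, by omega⟩)
    · rw [Finset.card_union_of_disjoint, hV3]
      · simp only [Nat.card_Ico]; omega
      · rw [Finset.disjoint_left]
        intro x hx hx'
        have := hV1 x hx'
        simp only [Finset.mem_Ico] at hx
        omega
    · have hmem : ∀ z, i ≤ z → z < i + l → (a ≤ z ∧ z < a + o) ∨ z ∈ V := fun z hz1 hz2 => by
        simpa only [Finset.mem_union, Finset.mem_Ico] using h z hz1 hz2
      rcases Nat.eq_zero_or_pos l with h0 | h0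
      · omega
      · rcases hmem i le_rfl (by omega) with hi | hi
        · by_contra hly
          rcases hmem (a + o) (by omega) (by omega) with h' | h'
          · omega
          · have := hV1 _ h'; omega
        · refine hV4 i l fun z hz1 hz2 => (hmem z hz1 hz2).resolve_left fun h' => ?_
          have := hV1 i hi
          omega
    · rw [Finset.union_assoc]
      exact hV5.prepend (z := a + o) (fun x hx => by have := hge x hx; omega)
        (Or.inr hge) (fun h' => by have := hge _ h'; omega) le_rfl (by omega)

theorem card_inter_Ico_of_forall {X V : Finset ℕ} {s e : ℕ}
    (h : ∀ i, s ≤ i → i < e → (i ∈ X ↔ i ∈ V)) (hV : ∀ x ∈ V, s ≤ x ∧ x < e) :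
    (X ∩ Finset.Ico s e).card = V.card := by
  congr 1
  ext i
  simp only [Finset.mem_inter, Finset.mem_Ico]
  exact ⟨fun hi => (h i hi.2.1 hi.2.2).1 hi.1, fun hi => ⟨(h i (hV i hi).1 (hV i hi).2).2 hi,
    hV i hi⟩⟩

/-- In each period `U` has a block of length `R = σ + k * p` and then `p` zeros, while `V` has a
pattern of `k + 1` short blocks and then a bridge of `p` ones, which merges with the pattern before
it and with whatever starts the next period. The estimate is stated for all sets that agree with `U`
and `V` from `a` on, so that it survives prepending further periods. -/
theorem exists_distant_codes {p r k σ y : ℕ} (hp : 2 ≤ p) (hk : 2 ≤ k) (hkσ : k + 1 ≤ σ)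
    (hσ : σ ≤ (k + 1) * y) (hr : σ + k * p ≤ r) (hy : 2 * y ≤ σ) {j : ℕ}
    (hj : j < σ + k * p + p) (q : ℕ) :
    ∀ a, ∃ (U V S : Finset ℕ) (f : Finset ℕ → ℤ), Code p r U ∧ Code p r V ∧ LipOn p r S f ∧
      (∀ x ∈ S, a ≤ x) ∧
      (∀ x ∈ U, a ≤ x ∧ x < a + (q * (σ + k * p + p) + j)) ∧
      (∀ x ∈ V, a ≤ x ∧ x < a + (q * (σ + k * p + p) + j)) ∧
      (a ∈ V ∨ ∀ x ∈ V, a + p ≤ x) ∧ (∃ z, z ∉ V ∧ a ≤ z ∧ z ≤ a + y) ∧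
      ∀ X Y : Finset ℕ, (∀ i, a ≤ i → (i ∈ X ↔ i ∈ U)) → (∀ i, a ≤ i → (i ∈ Y ↔ i ∈ V)) →
        (q * (σ + k * p + p) + j : ℤ) + q * (σ - 2 * y) ≤ f Y - f X := by
  have hkp : 2 * p ≤ k * p := Nat.mul_le_mul_right _ hk
  obtain ⟨R, hR⟩ : ∃ R, R = σ + k * p := ⟨_, rfl⟩
  have hRz : (R : ℤ) = σ + k * p := by rw [hR]; push_cast; ring
  rw [← hR] at hr hj ⊢
  rw [← hRz]
  induction q with
  | zero =>
    intro a
    -- The incomplete last period: `U` takes at most `R` letters and `V` the remaining ones, fewer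
    -- than `p`.
    refine ⟨Finset.Ico a (a + min j R), Finset.Ico (a + R) (a + j),
      Finset.Ico (a + R) (a + j) ∪ Finset.Ico a (a + min j R), _, code_Ico p (by omega),
      code_Ico p (by omega), (lipOn_card p r _).add (lipOn_card p r _).neg ?_, ?_, ?_, ?_, ?_, ?_,
      ?_⟩
    · rw [Finset.disjoint_left]
      intro x h1 h2
      simp only [Finset.mem_Ico] at h1 h2
      omega
    · intro x hx
      simp only [Finset.mem_union, Finset.mem_Ico] at hx
      omega
    · intro x hx
      simp only [Finset.mem_Ico] at hx
      omega
    · intro x hx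
      simp only [Finset.mem_Ico] at hx
      omega
    · right
      intro x hx
      simp only [Finset.mem_Ico] at hx
      omega
    · refine ⟨a, ?_, le_rfl, by omega⟩
      simp only [Finset.mem_Ico]
      omega
    · intro X Y hX hY
      have e1 : (Y ∩ Finset.Ico (a + R) (a + j)).card = j - R := by
        rw [card_inter_Ico_of_forall (fun i h1 _ => hY i (by omega))
          fun x hx => Finset.mem_Ico.1 hx, Nat.card_Ico]
        omega
      have e2 : (Y ∩ Finset.Ico a (a + min j R)).card = 0 := by
        rw [card_inter_Ico_of_forall (V := ∅) (fun i h1 h2 => ?_) (by simp), Finset.card_empty]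
        rw [hY i h1, Finset.mem_Ico]
        simp only [Finset.notMem_empty, iff_false]
        omega
      have e3 : (X ∩ Finset.Ico (a + R) (a + j)).card = 0 := by
        rw [card_inter_Ico_of_forall (V := ∅) (fun i h1 h2 => ?_) (by simp), Finset.card_empty]
        rw [hX i (by omega), Finset.mem_Ico]
        simp only [Finset.notMem_empty, iff_false]
        omega
      have e4 : (X ∩ Finset.Ico a (a + min j R)).card = min j R := by
        rw [card_inter_Ico_of_forall (fun i h1 _ => hX i (by omega))
          fun x hx => Finset.mem_Ico.1 hx, Nat.card_Ico]
        omega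
      rw [e1, e2, e3, e4]
      push_cast
      omega
  | succ q ih =>
    intro a
    obtain ⟨U, V, S, f, hU, hV, hf, hS, hU', hV', hVg, hVz, hdist⟩ := ih (a + R + p)
    obtain ⟨V', hV1, hV2, hV3, hV4, hV5⟩ := exists_pattern (by omega) (by omega) hV
      (fun x hx => (hV' x hx).1) hVg hVz k a σ hkσ hσ (by omega)
    rw [← hR] at hV1 hV5
    have hq : (q + 1) * (R + p) = q * (R + p) + (R + p) := by ring
    have hlip := (lipOn_card_sub_two_mul_maxRun hp r (Nat.le_add_right a R)).add
      ((lipOn_card p r (Finset.Ico (a + R) (a + R + p))).add hf (by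
        rw [Finset.disjoint_left]
        intro x h1 h2
        have := hS x h2
        simp only [Finset.mem_Ico] at h1
        omega)) (by
      rw [Finset.disjoint_left]
      intro x h1 h2
      simp only [Finset.mem_union, Finset.mem_Ico] at h1 h2
      rcases h2 with h2 | h2
      · omega
      · have := hS x h2; omega)
    refine ⟨Finset.Ico a (a + R) ∪ U, V' ∪ (Finset.Ico (a + R) (a + R + p) ∪ V), _, _, ?_, hV5,
      hlip, ?_, ?_, ?_, ?_, ?_, ?_⟩
    · exact hU.prepend (z := a + R) (fun x hx => by have := hU' x hx; omega)
        (Or.inr fun x hx => (hU' x hx).1) (fun h => by have := hU' _ h; omega) le_rfl (by omega)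
    · intro x hx
      simp only [Finset.mem_union, Finset.mem_Ico] at hx
      rcases hx with hx | hx | hx
      · omega
      · omega
      · have := hS x hx; omega
    · intro x hx
      simp only [Finset.mem_union, Finset.mem_Ico] at hx
      rcases hx with hx | hx
      · omega
      · have := hU' x hx; omega
    · intro x hx
      simp only [Finset.mem_union, Finset.mem_Ico] at hx
      rcases hx with hx | hx | hx
      · have := hV1 x hx; omega
      · omega
      · have := hV' x hx; omega
    · exact Or.inl (Finset.mem_union_left _ hV2)
    · by_contra! hno
      have := hV4 a (y + 1) fun z h1 h2 => by
        by_contra hzV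
        refine absurd (hno z ?_ h1) (by omega)
        simp only [Finset.mem_union, Finset.mem_Ico, not_or]
        exact ⟨hzV, by omega, fun h => by have := hV' z h; omega⟩
      omega
    -- The new period contributes `(σ - 2y) - (R - 2R) = R + σ - 2y` on the block and `p` on the
    -- bridge.
    · intro X Y hX hY
      have e1 : (X ∩ Finset.Ico a (a + R)).card = R := by
        rw [card_inter_Ico_of_forall (V := Finset.Ico a (a + R)) (fun i h1 h2 => ?_)
          fun x hx => Finset.mem_Ico.1 hx, Nat.card_Ico]
        · omega
        · rw [hX i h1]
          simp [h1, h2]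
      have e2 : R ≤ maxRun X a (a + R) := le_maxRun le_rfl le_rfl fun z h1 h2 => by
        rw [hX z h1]
        simp [h1, h2]
      have hYV : ∀ i, a ≤ i → i < a + R → (i ∈ Y ↔ i ∈ V') := by
        intro i h1 h2
        rw [hY i h1]
        simp only [Finset.mem_union, Finset.mem_Ico]
        constructor
        · rintro (h | h | h)
          · exact h
          · omega
          · have := hV' i h; omega
        · exact Or.inl
      have e3 : (Y ∩ Finset.Ico a (a + R)).card = σ := by
        rw [card_inter_Ico_of_forall hYV hV1, hV3]
      have e4 : maxRun Y a (a + R) ≤ y := by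
        obtain ⟨i, hi, hie, h⟩ := exists_maxRun (X := Y) (Nat.le_add_right a R)
        exact hV4 i _ fun z h1 h2 => (hYV z (by omega) (by omega)).1 (h z h1 h2)
      have e5 : (Y ∩ Finset.Ico (a + R) (a + R + p)).card = p := by
        rw [card_inter_Ico_of_forall (V := Finset.Ico (a + R) (a + R + p)) (fun i h1 h2 => ?_)
          fun x hx => Finset.mem_Ico.1 hx, Nat.card_Ico]
        · omega
        · rw [hY i (by omega)]
          simp [h1, h2]
      have e6 : (X ∩ Finset.Ico (a + R) (a + R + p)).card = 0 := by
        rw [card_inter_Ico_of_forall (V := ∅) (fun i h1 h2 => ?_) (by simp), Finset.card_empty]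
        rw [hX i (by omega)]
        simp only [Finset.mem_union, Finset.mem_Ico, Finset.notMem_empty, iff_false, not_or]
        exact ⟨by omega, fun h => by have := hU' i h; omega⟩
      have e7 := hdist X Y
        (fun i hi => by
          rw [hX i (by omega)]
          simp only [Finset.mem_union, Finset.mem_Ico, or_iff_right_iff_imp]
          omega)
        (fun i hi => by
          rw [hY i (by omega)]
          simp only [Finset.mem_union, Finset.mem_Ico]
          constructor
          · rintro (h | h | h)
            · have := hV1 i h; omega
            · omega
            · exact h
          · exact fun h => Or.inr (Or.inr h))
      rw [e1, e3, e5, e6]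
      have e2' : (R : ℤ) ≤ maxRun X a (a + R) := by exact_mod_cast e2
      have e4' : (maxRun Y a (a + R) : ℤ) ≤ y := by exact_mod_cast e4
      push_cast
      linarith

theorem add_mul_le_diam {p r k σ y : ℕ} (hp : 2 ≤ p) (hk : 2 ≤ k) (hkσ : k + 1 ≤ σ)
    (hσ : σ ≤ (k + 1) * y) (hr : σ + k * p ≤ r) (hy : 2 * y ≤ σ) (n : ℕ) :
    n + (σ - 2 * y) * (n / (σ + k * p + p)) ≤ (IFibCube p r n).diam := by
  obtain ⟨U, V, S, f, hU, hV, hf, -, hU', hV', -, -, hdist⟩ := exists_distant_codes hp hk hkσ hσ hr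
    hy (Nat.mod_lt n (by omega : 0 < σ + k * p + p)) (n / (σ + k * p + p)) 0
  have hn : n / (σ + k * p + p) * (σ + k * p + p) + n % (σ + k * p + p) = n :=
    Nat.div_add_mod' n _
  have h1 := hdist U V (fun _ _ => Iff.rfl) (fun _ _ => Iff.rfl)
  have h2 := hf.le_diam (n := n) hU hV
    (fun x hx => by have := hU' x hx; omega) (fun x hx => by have := hV' x hx; omega)
  have h3 := h1.trans h2
  generalize n / (σ + k * p + p) = q at *
  have hn' : (q * (σ + k * p + p) + (n % (σ + k * p + p) : ℕ) : ℤ) = n := by exact_mod_cast hn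
  rw [hn'] at h3
  obtain ⟨c, hc⟩ : ∃ c, σ = 2 * y + c := ⟨σ - 2 * y, by omega⟩
  have hc' : (σ : ℤ) - 2 * y = c := by rw [hc]; push_cast; ring
  rw [hc'] at h3
  rw [show σ - 2 * y = c by omega, mul_comm c]
  exact_mod_cast h3


/-! ### Upper bounds for the diameter -/

/-- The ones in the window either form a single run, of length at most `r`, or surround a gap of at
least `p` zeros, which leaves at most `l - p ≤ r` ones. -/
theorem Code.card_inter_window_le {p r : ℕ} {X : Finset ℕ} (hX : Code p r X) {a l : ℕ}
    (hl : l ≤ p + r) : (X ∩ Finset.Ico a (a + l)).card ≤ r := by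
  classical
  rcases (X ∩ Finset.Ico a (a + l)).eq_empty_or_nonempty with h | hne
  · simp [h]
  have hmin := Finset.min'_mem _ hne
  have hmax := Finset.max'_mem _ hne
  have hle : ∀ x ∈ X ∩ Finset.Ico a (a + l), (X ∩ Finset.Ico a (a + l)).min' hne ≤ x ∧
      x ≤ (X ∩ Finset.Ico a (a + l)).max' hne :=
    fun x hx => ⟨Finset.min'_le _ x hx, Finset.le_max' _ x hx⟩
  generalize (X ∩ Finset.Ico a (a + l)).min' hne = s at *
  generalize (X ∩ Finset.Ico a (a + l)).max' hne = e at *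
  simp only [Finset.mem_inter, Finset.mem_Ico] at hmin hmax
  by_cases hrun : ∀ z, s ≤ z → z < e + 1 → z ∈ X
  · have h1 := hX.length_le hrun
    have h2 : X ∩ Finset.Ico a (a + l) ⊆ Finset.Ico s (e + 1) := fun x hx => by
      have := hle x hx
      exact Finset.mem_Ico.2 ⟨by omega, by omega⟩
    have h3 := Finset.card_le_card h2
    rw [Nat.card_Ico] at h3
    omega
  · push Not at hrun
    obtain ⟨z, hz1, hz2, hz3⟩ := hrun
    have hzs : z ≠ s := fun h => hz3 (h ▸ hmin.1)
    have hze : z ≠ e := fun h => hz3 (h ▸ hmax.1)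
    obtain ⟨i, j, h1, h2, h3, h4, -, -, h5, h6⟩ := hX.exists_gap hmin.1 hmax.1 hz3
      (by omega) (by omega)
    have h7 : X ∩ Finset.Ico a (a + l) ⊆ Finset.Ico a (i + 1) ∪ Finset.Ico j (a + l) := by
      intro x hx
      simp only [Finset.mem_inter, Finset.mem_union, Finset.mem_Ico] at hx ⊢
      by_contra hno
      exact h6 x (by omega) (by omega) hx.1
    have h8 := (Finset.card_le_card h7).trans (Finset.card_union_le _ _)
    simp only [Nat.card_Ico] at h8
    omega

/-- A window of length `l ≤ p + r` contains at most `min l (2 * r)` differences, and the interval is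
cut into such windows. -/
theorem card_symmDiff_inter_Ico_le {p r : ℕ} {X Y : Finset ℕ} (hX : Code p r X)
    (hY : Code p r Y) {j : ℕ} (hj : j < p + r) (q : ℕ) : ∀ a,
    (symmDiff X Y ∩ Finset.Ico a (a + (q * (p + r) + j))).card ≤
      q * (2 * r) + min j (2 * r) := by
  classical
  have hwindow : ∀ a l, l ≤ p + r →
      (symmDiff X Y ∩ Finset.Ico a (a + l)).card ≤ min l (2 * r) := by
    intro a l hl
    have h1 : symmDiff X Y ∩ Finset.Ico a (a + l) ⊆
        (X ∩ Finset.Ico a (a + l)) ∪ (Y ∩ Finset.Ico a (a + l)) := by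
      intro x hx
      simp only [Finset.mem_inter, Finset.mem_symmDiff, Finset.mem_union] at hx ⊢
      tauto
    have h2 := (Finset.card_le_card h1).trans (Finset.card_union_le _ _)
    have h3 := hX.card_inter_window_le (a := a) hl
    have h4 := hY.card_inter_window_le (a := a) hl
    have h5 := Finset.card_le_card
      (Finset.inter_subset_right : symmDiff X Y ∩ Finset.Ico a (a + l) ⊆ Finset.Ico a (a + l))
    rw [Nat.card_Ico] at h5
    omega
  induction q with
  | zero =>
    intro a
    simpa using hwindow a j hj.le
  | succ q ih =>
    intro a
    have h1 := hwindow a (p + r) le_rfl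
    have h2 := ih (a + (p + r))
    have hq : (q + 1) * (p + r) = q * (p + r) + (p + r) := by ring
    have hq' : (q + 1) * (2 * r) = q * (2 * r) + 2 * r := by ring
    rw [show a + ((q + 1) * (p + r) + j) = a + (p + r) + (q * (p + r) + j) by omega,
      ← Finset.Ico_union_Ico_eq_Ico (Nat.le_add_right a (p + r)) (Nat.le_add_right _ _),
      Finset.inter_union_distrib_left]
    have h3 := Finset.card_union_le (symmDiff X Y ∩ Finset.Ico a (a + (p + r)))
      (symmDiff X Y ∩ Finset.Ico (a + (p + r)) (a + (p + r) + (q * (p + r) + j)))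
    omega

/-- If the blocks are not longer than the gaps, a block of `X` meets at most one block of `Y`. -/
theorem Code.convIn_inter {p r : ℕ} (hrp : r ≤ p) {X Y : Finset ℕ} (hX : Code p r X)
    (hY : Code p r Y) : ConvIn (X ∩ Y) X := by
  intro a b c ha hc hab hbc hz
  simp only [Finset.mem_inter] at ha hc ⊢
  refine ⟨hz b hab.le hbc.le, ?_⟩
  by_contra hb
  obtain ⟨i, j, h1, h2, h3, h4, -, -, h5, -⟩ := hY.exists_gap ha.2 hc.2 hb hab hbc
  have := hX.length_le (a := a) (b := c + 1) fun z hz1 hz2 => hz z hz1 (by omega)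
  omega

theorem card_add_card_eq {X Y : Finset ℕ} :
    X.card + Y.card = (symmDiff X Y).card + 2 * (X ∩ Y).card := by
  classical
  have h1 := Finset.card_sdiff_add_card_inter X Y
  have h2 := Finset.card_sdiff_add_card_inter Y X
  rw [Finset.inter_comm Y X] at h2
  have h3 : (symmDiff X Y).card = (X \ Y).card + (Y \ X).card := by
    rw [symmDiff_def, Finset.sup_eq_union, Finset.card_union_of_disjoint disjoint_sdiff_sdiff]
  omega

theorem diam_le_of_lt {p r : ℕ} (hrp : r < p) (n : ℕ) :
    (IFibCube p r n).diam ≤ n / (p + r) * (2 * r) + min (n % (p + r)) (2 * r) := by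
  refine diam_le_of_common fun X Y hX hY hXn hYn => ⟨X ∩ Y, Finset.inter_subset_left,
    Finset.inter_subset_right, Or.inr ⟨hX.convIn_inter hrp.le hY, ?_⟩, ?_⟩
  · rw [Finset.inter_comm]
    exact hY.convIn_inter hrp.le hX
  · have h1 := card_symmDiff_inter_Ico_le hX hY (Nat.mod_lt n (by omega : 0 < p + r))
      (n / (p + r)) 0
    rw [Nat.div_add_mod' n (p + r), Finset.inter_eq_left.2] at h1
    · rw [card_add_card_eq]
      omega
    · intro x hx
      rw [Finset.mem_Ico]
      rcases Finset.mem_symmDiff.1 hx with h | h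
      · have := hXn x h.1; omega
      · have := hYn x h.1; omega

theorem diam_le_of_one (r n : ℕ) : (IFibCube 1 r n).diam ≤ n := by
  refine diam_le_of_common fun X Y _ _ hXn hYn => ⟨X ∩ Y, Finset.inter_subset_left,
    Finset.inter_subset_right, Or.inl rfl, ?_⟩
  have h1 : symmDiff X Y ⊆ Finset.range n := by
    intro x hx
    rw [Finset.mem_range]
    rcases Finset.mem_symmDiff.1 hx with h | h
    · exact hXn x h.1
    · exact hYn x h.1
  have h2 := Finset.card_le_card h1
  rw [Finset.card_range] at h2
  rw [card_add_card_eq]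
  omega

theorem diam_le_of_star {p r c R n : ℕ} (hR : 1 ≤ R)
    (hstar : ∀ k σ y, σ ≤ (k + 1) * y → σ + k * p ≤ r → σ + k * p ≤ n →
      R * σ ≤ 2 * (R * y) + c * (σ + k * p)) {m : ℕ} (hm : n ≤ R * m) :
    (IFibCube p r n).diam ≤ n + c * m := by
  refine diam_le_of_common fun X Y hX hY hXn hYn => ?_
  obtain ⟨W, h1, h2, h3, h4, h5⟩ := exists_large_common hstar hX hY hXn hYn
  refine ⟨W, h1, h2, Or.inr ⟨h3, h4⟩, ?_⟩
  have h6 : c * n ≤ c * (R * m) := Nat.mul_le_mul_left _ hm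
  refine Nat.le_of_mul_le_mul_left ?_ hR
  linarith

/-- With `c = 0` and `R = 1` the block inequality is `σ ≤ 2y`. It could fail only for `k ≥ 2` and `y
≥ 1`, thus `σ ≥ 3`, and then `σ + k * p ≥ 2p + 3` exceeds `r` or `n`. -/
theorem diam_le_self {p r n : ℕ} (h : r ≤ 2 * p + 2 ∨ n < 2 * p + 3) :
    (IFibCube p r n).diam ≤ n := by
  have := diam_le_of_star (p := p) (r := r) (c := 0) (R := 1) (n := n) le_rfl
    (fun k σ y h1 h2 h3 => ?_) (m := n) (by omega)
  · simpa using this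
  · rcases Nat.lt_or_ge k 2 with hk | hk
    · have : (k + 1) * y ≤ 2 * y := Nat.mul_le_mul_right _ (by omega)
      omega
    · have h4 : 2 * p ≤ k * p := Nat.mul_le_mul_right _ hk
      rcases Nat.eq_zero_or_pos y with h0 | h0
      · subst h0; omega
      · omega

theorem le_diam_self {p r : ℕ} (hp : 1 ≤ p) (hpr : p ≤ r) (n : ℕ) :
    n ≤ (IFibCube p r n).diam := by
  have h := two_mul_blocks_le_diam hp hp le_rfl hpr n
  have h1 := Nat.mod_lt n (by omega : 0 < p + p)
  have h2 := Nat.div_add_mod' n (p + p)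
  rw [show 2 * p = p + p by ring, min_eq_left h1.le, h2] at h
  exact h

/-! ### The optimal block and the conclusion -/

/-- A block with parameters of maximal ratio. -/
theorem exists_optimal_star {p r : ℕ} (hp : 1 ≤ p) (hr : 2 * p + 3 ≤ r) :
    ∃ k σ y : ℕ, 2 ≤ k ∧ k + 1 ≤ σ ∧ σ ≤ (k + 1) * y ∧ σ + k * p ≤ r ∧ 2 * y < σ ∧
      ∀ k' σ' y' : ℕ, σ' ≤ (k' + 1) * y' → σ' + k' * p ≤ r →
        (σ + k * p) * σ' ≤ 2 * ((σ + k * p) * y') + (σ - 2 * y) * (σ' + k' * p) := by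
  classical
  let T : Finset (ℕ × ℕ × ℕ) :=
    (Finset.range (r + 1) ×ˢ Finset.range (r + 1) ×ˢ Finset.range (r + 1)).filter fun t =>
      2 ≤ t.1 ∧ t.1 + 1 ≤ t.2.1 ∧ t.2.1 ≤ (t.1 + 1) * t.2.2 ∧ t.2.1 + t.1 * p ≤ r ∧
        2 * t.2.2 < t.2.1
  have hT : ∀ k σ y : ℕ, 2 ≤ k → k + 1 ≤ σ → σ ≤ (k + 1) * y → σ + k * p ≤ r → 2 * y < σ →
      (k, σ, y) ∈ T := by
    intro k σ y h1 h2 h3 h4 h5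
    simp only [T, Finset.mem_filter, Finset.mem_product, Finset.mem_range]
    exact ⟨⟨by omega, by omega, by omega⟩, h1, h2, h3, h4, h5⟩
  -- The triple maximises `(σ - 2y) / (σ + k * p)`. The set is nonempty because three single letters
  -- with two gaps of length `p` fit into a block of length `2p + 3 ≤ r`.
  obtain ⟨⟨k, σ, y⟩, hmem, hmax⟩ := T.exists_max_image
    (fun t => (((t.2.1 - 2 * t.2.2 : ℕ) : ℚ)) / ((t.2.1 + t.1 * p : ℕ) : ℚ))
    ⟨(2, 3, 1), hT 2 3 1 le_rfl le_rfl le_rfl (by omega) (by omega)⟩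
  simp only [T, Finset.mem_filter] at hmem
  obtain ⟨-, h1, h2, h3, h4, h5⟩ := hmem
  refine ⟨k, σ, y, h1, h2, h3, h4, h5, ?_⟩
  have hratio : ∀ k' σ' y' : ℕ, 2 ≤ k' → k' + 1 ≤ σ' → σ' ≤ (k' + 1) * y' → σ' + k' * p ≤ r →
      2 * y' < σ' → (σ + k * p) * (σ' - 2 * y') ≤ (σ - 2 * y) * (σ' + k' * p) := by
    intro k' σ' y' g1 g2 g3 g4 g5
    have h := hmax _ (hT k' σ' y' g1 g2 g3 g4 g5)
    simp only at h
    rw [div_le_div_iff₀ (by exact_mod_cast (by omega : 0 < σ' + k' * p))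
      (by exact_mod_cast (by omega : 0 < σ + k * p))] at h
    rw [mul_comm]
    exact_mod_cast h
  intro k' σ' y' g1 g2
  rcases Nat.lt_or_ge (2 * y') σ' with hlt | hge
  · suffices hs : (σ + k * p) * (σ' - 2 * y') ≤ (σ - 2 * y) * (σ' + k' * p) by
      have : (σ + k * p) * σ' = 2 * ((σ + k * p) * y') + (σ + k * p) * (σ' - 2 * y') := by
        obtain ⟨d, hd⟩ : ∃ d, σ' = 2 * y' + d := ⟨σ' - 2 * y', by omega⟩
        rw [hd, Nat.add_sub_cancel_left]
        ring
      omega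
    have hy' : 1 ≤ y' := by
      rcases Nat.eq_zero_or_pos y' with h0 | h0
      · subst h0; omega
      · exact h0
    -- With fewer letters than pieces some pieces are empty. Then `σ'` single letters with `σ' - 1`
    -- gaps cost at least as much in no greater length.
    rcases Nat.lt_or_ge σ' (k' + 1) with hk | hk
    · have hkp : (σ' - 1) * p ≤ k' * p := Nat.mul_le_mul_right _ (by omega)
      have h := hratio (σ' - 1) σ' 1 (by omega) (by omega) (by omega) (by omega) (by omega)
      calc (σ + k * p) * (σ' - 2 * y') ≤ (σ + k * p) * (σ' - 2 * 1) :=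
            Nat.mul_le_mul_left _ (by omega)
        _ ≤ (σ - 2 * y) * (σ' + (σ' - 1) * p) := h
        _ ≤ _ := Nat.mul_le_mul_left _ (by omega)
    · refine hratio k' σ' y' ?_ hk g1 g2 hlt
      by_contra hk2
      have : (k' + 1) * y' ≤ 2 * y' := Nat.mul_le_mul_right _ (by omega)
      omega
  · have : (σ + k * p) * σ' ≤ (σ + k * p) * (2 * y') := Nat.mul_le_mul_left _ hge
    have h' : (σ + k * p) * (2 * y') = 2 * ((σ + k * p) * y') := by ring
    omega

theorem theorem4p5 (p r : ℕ) (hp : 1 ≤ p) (hr : 1 ≤ r) :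
    (p = 1 → ∀ n : ℕ, 1 ≤ n → (IFibCube p r n).diam = n) ∧
    (2 ≤ p →
      (r < p → ∀ n : ℕ, 1 ≤ n →
        (IFibCube p r n).diam = 2 * r * ⌊(n : ℚ) / ((p : ℚ) + (r : ℚ))⌋₊
          + min (n % (p + r)) (2 * r)) ∧
      (p ≤ r ∧ r ≤ p + 1 → ∀ n : ℕ, 1 ≤ n → (IFibCube p r n).diam = n) ∧
      (p + 2 ≤ r ∧ r ≤ 2 * p + 2 → ∀ n : ℕ, 1 ≤ n → (IFibCube p r n).diam = n) ∧
      (2 * p + 3 ≤ r → ∀ n : ℕ, 1 ≤ n → n < 2 * p + 3 → (IFibCube p r n).diam = n) ∧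
      (2 * p + 3 ≤ r →
        ∃ c r' : ℕ, 1 ≤ c ∧ 2 * p + 3 ≤ r' ∧ r' ≤ r ∧
          ∀ n : ℕ, 2 * p + 3 ≤ n →
            n + c * ⌊(n : ℚ) / ((r' : ℚ) + (p : ℚ))⌋₊ ≤ (IFibCube p r n).diam ∧
            (IFibCube p r n).diam ≤ n + c * ⌈(n : ℚ) / (r' : ℚ)⌉₊)) := by
  have hfloor : ∀ n a b : ℕ, ⌊(n : ℚ) / ((a : ℚ) + (b : ℚ))⌋₊ = n / (a + b) := by
    intro n a b
    rw [← Nat.cast_add, Nat.floor_div_eq_div]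
  refine ⟨?_, fun hp2 => ⟨?_, ?_, ?_, ?_, ?_⟩⟩
  · rintro rfl n -
    exact le_antisymm (diam_le_of_one r n) (le_diam_self le_rfl hr n)
  · intro hrp n _
    rw [hfloor, mul_comm (2 * r)]
    exact le_antisymm (diam_le_of_lt hrp n) (two_mul_blocks_le_diam hp hr hrp.le le_rfl n)
  · intro h n _
    exact le_antisymm (diam_le_self (Or.inl (by omega))) (le_diam_self hp h.1 n)
  · intro h n _
    exact le_antisymm (diam_le_self (Or.inl h.2)) (le_diam_self hp (by omega) n)
  · intro h n _ hn
    exact le_antisymm (diam_le_self (Or.inr hn)) (le_diam_self hp (by omega) n)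
  · intro h
    obtain ⟨k, σ, y, h1, h2, h3, h4, h5, hmax⟩ := exists_optimal_star hp h
    have hkp : 2 * p ≤ k * p := Nat.mul_le_mul_right _ h1
    -- The same block length is divided into `n` in both bounds; the additional `p` in the lower
    -- bound is the gap after each full block.
    refine ⟨σ - 2 * y, σ + k * p, by omega, by omega, h4, fun n _ => ⟨?_, ?_⟩⟩
    · rw [hfloor]
      exact add_mul_le_diam hp2 h1 h2 h3 h4 h5.le n
    · refine diam_le_of_star (by omega) (fun k' σ' y' g1 g2 _ => hmax k' σ' y' g1 g2) ?_
      have hpos : (0 : ℚ) < ((σ + k * p : ℕ) : ℚ) := by exact_mod_cast (by omega : 0 < σ + k * p)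
      have := (div_le_iff₀' hpos).1 (Nat.le_ceil ((n : ℚ) / ((σ + k * p : ℕ) : ℚ)))
      exact_mod_cast this
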